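/- Let $\mathbb T=\mathbb R/2\pi\mathbb Z$, let $L^2(\mathbb T)$ carry the inner product $\langle f\mid g\rangle=\int_0^{2\pi}f\bar g\,\frac{dx}{2\pi}$, and put $L^2_+(\mathbb T)=\{f\in L^2(\mathbb T):\hat f(n)=0\ \text{for all } n<0\}$, with orthogonal projector $\Pi:L^2(\mathbb T)\to L^2_+(\mathbb T)$. For $s\ge 0$ let $H^s_+(\mathbb T)=H^s(\mathbb T)\cap L^2_+(\mathbb T)$ with norm $\|f\|_{H^s}^2=\sum_n(1+n^2)^s|\hat f(n)|^2$. Write $D=-i\partial_x$, $D_+=D\Pi$, $T_bf=\Pi(bf)$ for $b\in L^\infty(\mathbb T)$, let $Sh=e^{ix}h$ be the shift operator on $L^2_+(\mathbb T)$ and $S^*$ its adjoint in $L^2_+(\mathbb T)$. For bounded $u_0$, let $L_{u_0}=D-T_{u_0}T_{\bar u_0}$ on $L^2_+(\mathbb T)$ with domain $H^1_+(\mathbb T)$. Let $s>\frac32$ and $u_0\in H^s_+(\mathbb T)$. Then there is a unique strongly continuous one-parameter unitary group $(e^{i\tau L_{u_0}})_{\tau\in\mathbb R}$ on $L^2_+(\mathbb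 T)$ with infinitesimal generator $iL_{u_0}$. Moreover, let $I\subset\mathbb R$ be an interval containing $0$ and let $u\in\mathcal C(I,H^s_+(\mathbb T))$ be a solution (in the sense of distributions, that is, for each Fourier coefficient in $x$) of $$i\partial_tu+\partial_x^2u+2D_+(|u|^2)u=0,\qquad u(0)=u_0. \tag{CS$^+$}$$ Then, for every $t\in I$ and every $z\in\mathbb C$ with $|z|<1$, the bounded operator $\mathrm{Id}-ze^{-it}e^{-2itL_{u_0}}S^*$ on $L^2_+(\mathbb T)$ is invertible, and $$u(t,z)=\big\langle(\mathrm{Id}-ze^{-it}e^{-2itL_{u_0}}S^*)^{-1}u_0\mid 1\big\rangle,$$ where $u(t,z)=\sum_{k\ge0}\hat u(t,k)z^k$ is the holomorphic extension of $u(t)$ to the unit disc. -/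

import Mathlib

open MeasureTheory AddCircle
open scoped ENNReal ComplexConjugate Topology

noncomputable section

namespace CalogeroSutherland

instance factTwoPiPos : Fact (0 < 2 * Real.pi) := ⟨Real.two_pi_pos⟩

/-- The torus `ℝ / 2πℤ`. -/
abbrev Torus : Type := AddCircle (2 * Real.pi)

/-- `L²(𝕋)` for the normalized measure `dx / 2π`. -/
abbrev L2T : Type := Lp ℂ 2 (haarAddCircle : Measure Torus)

/-- `L^∞(𝕋)`. -/
abbrev LinfT : Type := Lp ℂ ∞ (haarAddCircle : Measure Torus)

/-! ### Fourier coefficients on `L²(𝕋)` -/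

theorem repr_eq_fourierCoeff (f : L2T) (n : ℤ) :
    (fourierBasis (T := 2 * Real.pi)).repr f n = fourierCoeff (f : Torus → ℂ) n :=
  fourierBasis_repr f n

theorem fourierCoeff_L2_add (f g : L2T) (n : ℤ) :
    fourierCoeff ((f + g : L2T) : Torus → ℂ) n
      = fourierCoeff (f : Torus → ℂ) n + fourierCoeff (g : Torus → ℂ) n := by
  simp only [← repr_eq_fourierCoeff, map_add]; rfl

theorem fourierCoeff_L2_smul (c : ℂ) (f : L2T) (n : ℤ) :
    fourierCoeff ((c • f : L2T) : Torus → ℂ) n = c * fourierCoeff (f : Torus → ℂ) n := by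
  simp only [← repr_eq_fourierCoeff, map_smul]; rfl

theorem fourierCoeff_L2_zero (n : ℤ) : fourierCoeff ((0 : L2T) : Torus → ℂ) n = 0 := by
  simp only [← repr_eq_fourierCoeff, map_zero]; rfl

theorem fourierCoeff_L2_eq_inner (f : L2T) (n : ℤ) :
    fourierCoeff (f : Torus → ℂ) n = inner ℂ (fourierLp 2 n : L2T) f := by
  rw [← repr_eq_fourierCoeff, HilbertBasis.repr_apply_apply, coe_fourierBasis]

/-! ### Hardy space -/

/-- The Hardy space `L²₊(𝕋)`: no negative frequencies. -/
def hardy : Submodule ℂ L2T where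
  carrier := {f | ∀ n : ℤ, n < 0 → fourierCoeff (f : Torus → ℂ) n = 0}
  add_mem' {f g} hf hg n hn := by rw [fourierCoeff_L2_add, hf n hn, hg n hn, add_zero]
  zero_mem' n _ := fourierCoeff_L2_zero n
  smul_mem' c f hf n hn := by rw [fourierCoeff_L2_smul, hf n hn, mul_zero]

theorem mem_hardy {f : L2T} :
    f ∈ hardy ↔ ∀ n : ℤ, n < 0 → fourierCoeff (f : Torus → ℂ) n = 0 := Iff.rfl

theorem isClosed_hardy : IsClosed (hardy : Set L2T) := by
  have : (hardy : Set L2T)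
      = ⋂ (n : ℤ) (_ : n < 0), {f : L2T | inner ℂ (fourierLp 2 n : L2T) f = 0} := by
    ext f
    simp only [SetLike.mem_coe, mem_hardy, fourierCoeff_L2_eq_inner, Set.mem_iInter,
      Set.mem_ofPred_eq]
  rw [this]
  exact isClosed_iInter fun n => isClosed_iInter fun _ =>
    isClosed_eq (continuous_const.inner continuous_id) continuous_const

instance completeSpace_hardy : CompleteSpace hardy := isClosed_hardy.completeSpace_coe

/-- The Szegő projector `Π`, the orthogonal projection of `L²(𝕋)` onto `L²₊(𝕋)`. -/
def szego : L2T →L[ℂ] hardy := hardy.orthogonalProjectionOnto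

theorem fourierLp_mem_hardy {n : ℤ} (hn : 0 ≤ n) : (fourierLp 2 n : L2T) ∈ hardy := by
  intro m hm
  rw [fourierCoeff_L2_eq_inner]
  exact (orthonormal_iff_ite.mp (orthonormal_fourier (T := 2 * Real.pi)) m n).trans
    (if_neg (by omega))

/-- `Π` truncates the Fourier series to the nonnegative frequencies. -/
theorem fourierCoeff_szego (f : L2T) (n : ℤ) :
    fourierCoeff ((szego f : L2T) : Torus → ℂ) n
      = if 0 ≤ n then fourierCoeff (f : Torus → ℂ) n else 0 := by
  split_ifs with hn
  · rw [fourierCoeff_L2_eq_inner, fourierCoeff_L2_eq_inner, szego]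
    have h := Submodule.inner_orthogonalProjectionOnto_eq_of_mem_right
      (K := hardy) ⟨_, fourierLp_mem_hardy hn⟩ f
    rw [← inner_conj_symm, ← inner_conj_symm (fourierLp 2 n : L2T) f]
    exact congrArg _ h
  · exact (szego f).2 n (not_le.mp hn)

/-- The constant function `1`, as an element of `L²₊(𝕋)`. -/
def hardyOne : hardy := ⟨fourierLp 2 0, fourierLp_mem_hardy le_rfl⟩

theorem coeFn_hardyOne : ((hardyOne : L2T) : Torus → ℂ) =ᵐ[haarAddCircle] fun _ => 1 := by
  filter_upwards [coeFn_fourierLp (T := 2 * Real.pi) 2 0] with x hx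
  exact hx.trans fourier_zero

/-! ### Sobolev spaces -/

/-- The `n`-th term of the square of the `H^s(𝕋)` norm, `(1 + n²)^s |f̂(n)|²`. -/
def sobolevTerm (s : ℝ) (f : L2T) (n : ℤ) : ℝ :=
  (1 + (n : ℝ) ^ 2) ^ s * ‖fourierCoeff (f : Torus → ℂ) n‖ ^ 2

theorem sobolevTerm_nonneg (s : ℝ) (f : L2T) (n : ℤ) : 0 ≤ sobolevTerm s f n := by
  unfold sobolevTerm; positivity

/-- The Sobolev space `H^s(𝕋)`, `s ≥ 0`, as a subspace of `L²(𝕋)`. -/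
def sobolev (s : ℝ) : Submodule ℂ L2T where
  carrier := {f | Summable (sobolevTerm s f)}
  add_mem' {f g} hf hg := by
    refine Summable.of_nonneg_of_le (sobolevTerm_nonneg s _) (fun n => ?_)
      ((Summable.add hf hg).mul_left 2)
    have h1 : ‖fourierCoeff ((f + g : L2T) : Torus → ℂ) n‖ ^ 2
        ≤ 2 * (‖fourierCoeff (f : Torus → ℂ) n‖ ^ 2 + ‖fourierCoeff (g : Torus → ℂ) n‖ ^ 2) := by
      rw [fourierCoeff_L2_add]
      have := norm_add_le (fourierCoeff (f : Torus → ℂ) n) (fourierCoeff (g : Torus → ℂ) n)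
      nlinarith [sq_nonneg (‖fourierCoeff (f : Torus → ℂ) n‖ - ‖fourierCoeff (g : Torus → ℂ) n‖),
        norm_nonneg (fourierCoeff (f : Torus → ℂ) n + fourierCoeff (g : Torus → ℂ) n)]
    have h2 : 0 ≤ (1 + (n : ℝ) ^ 2) ^ s := by positivity
    have h3 := mul_le_mul_of_nonneg_left h1 h2
    unfold sobolevTerm
    linarith
  zero_mem' := by
    refine summable_zero.congr fun n => ?_
    rw [sobolevTerm, fourierCoeff_L2_zero]; simp
  smul_mem' c f hf := by
    refine (Summable.mul_left (‖c‖ ^ 2) hf).congr fun n => ?_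
    simp only [sobolevTerm, fourierCoeff_L2_smul, norm_mul]
    ring

/-- The Sobolev norm `‖f‖_{H^s} = (∑ₙ (1 + n²)^s |f̂(n)|²)^{1/2}`, meaningful for `f ∈ H^s(𝕋)`. -/
def sobolevNorm (s : ℝ) (f : L2T) : ℝ := Real.sqrt (∑' n : ℤ, sobolevTerm s f n)

/-- `H^s₊(𝕋) = H^s(𝕋) ∩ L²₊(𝕋)`, as a subspace of `L²₊(𝕋)`. -/
def hardySobolev (s : ℝ) : Submodule ℂ hardy := (sobolev s).comap hardy.subtype

theorem summable_fourierCoeff_of_mem_sobolev {s : ℝ} (hs : 1 / 2 < s) {f : L2T}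
    (hf : f ∈ sobolev s) : Summable fun n : ℤ => fourierCoeff (f : Torus → ℂ) n := by
  have hw : Summable fun n : ℤ => (1 + (n : ℝ) ^ 2) ^ (-s) := by
    have h : Summable fun n : ℤ => |(n : ℝ)| ^ (-(2 * s)) :=
      Real.summable_abs_int_rpow (by linarith)
    refine Summable.of_norm_bounded_eventually h ?_
    filter_upwards [(Set.finite_singleton (0 : ℤ)).compl_mem_cofinite] with n hn
    have hn0 : (n : ℝ) ≠ 0 := by exact_mod_cast hn
    have hp : 0 < (n : ℝ) ^ 2 := by positivity
    rw [Real.norm_of_nonneg (by positivity), show -(2 * s) = 2 * (-s) by ring,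
      Real.rpow_mul (abs_nonneg _), Real.rpow_two, sq_abs]
    exact Real.rpow_le_rpow_of_nonpos hp (by linarith) (by linarith)
  refine Summable.of_norm_bounded (hw.add hf) fun n => ?_
  have hb : 0 < (1 + (n : ℝ) ^ 2) := by positivity
  set a := ‖fourierCoeff (f : Torus → ℂ) n‖ with ha
  have ha0 : 0 ≤ a := norm_nonneg _
  have hA : 0 < (1 + (n : ℝ) ^ 2) ^ (s / 2) := by positivity
  have e1 : (1 + (n : ℝ) ^ 2) ^ s = ((1 + (n : ℝ) ^ 2) ^ (s / 2)) ^ 2 := by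
    rw [← Real.rpow_two (x := _ ^ (s / 2)), ← Real.rpow_mul hb.le]; congr 1; ring
  have e2 : (1 + (n : ℝ) ^ 2) ^ (-s) = (((1 + (n : ℝ) ^ 2) ^ (s / 2))⁻¹) ^ 2 := by
    rw [Real.rpow_neg hb.le, e1, inv_pow]
  simp only [sobolevTerm, ← ha]
  rw [e1, e2]
  set A := (1 + (n : ℝ) ^ 2) ^ (s / 2)
  have hAA : A⁻¹ * A = 1 := inv_mul_cancel₀ hA.ne'
  have hAi : 0 < A⁻¹ := by positivity
  have key : a = A⁻¹ * (A * a) := by rw [← mul_assoc, hAA, one_mul]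
  nlinarith [sq_nonneg (A⁻¹ - A * a), mul_nonneg hAi.le (mul_nonneg hA.le ha0),
    sq_nonneg (A⁻¹), sq_nonneg (A * a)]

/-- Functions in `H^s(𝕋)`, `s > 1/2`, are bounded. -/
theorem memLp_top_of_mem_sobolev {s : ℝ} (hs : 1 / 2 < s) {f : L2T} (hf : f ∈ sobolev s) :
    MemLp (f : Torus → ℂ) ∞ haarAddCircle := by
  have hsum := summable_fourierCoeff_of_mem_sobolev hs hf
  have h1 : HasSum (fun n : ℤ => fourierCoeff (f : Torus → ℂ) n • (fourier n : C(Torus, ℂ)))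
      (∑' n : ℤ, fourierCoeff (f : Torus → ℂ) n • (fourier n : C(Torus, ℂ))) := by
    refine (Summable.of_norm ?_).hasSum
    simpa only [norm_smul, fourier_norm, mul_one] using hsum.norm
  set F : C(Torus, ℂ) := ∑' n : ℤ, fourierCoeff (f : Torus → ℂ) n • (fourier n : C(Torus, ℂ))
  have h2 := (ContinuousMap.toLp (E := ℂ) 2 (haarAddCircle : Measure Torus) ℂ).hasSum h1
  have h3 := hasSum_fourier_series_L2 f
  have h4 : ContinuousMap.toLp (E := ℂ) 2 (haarAddCircle : Measure Torus) ℂ F = f := by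
    refine h2.unique ?_
    convert h3 using 2 with n
    simp [fourierLp]
  have h5 : (f : Torus → ℂ) =ᵐ[haarAddCircle] F := by
    rw [← h4]
    exact ContinuousMap.coeFn_toLp _ _
  exact (memLp_top_of_bound F.continuous.aestronglyMeasurable ‖F‖
    (Filter.Eventually.of_forall F.norm_coe_le_norm)).ae_eq h5.symm

/-- An element of `H^s(𝕋)`, `s > 1/2`, as an element of `L^∞(𝕋)`. -/
def toLinf {s : ℝ} (hs : 1 / 2 < s) {f : L2T} (hf : f ∈ sobolev s) : LinfT :=
  (memLp_top_of_mem_sobolev hs hf).toLp f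

/-! ### The operators -/

theorem memlp_deriv {f : L2T} (hf : f ∈ sobolev 1) :
    Memℓp (fun n : ℤ => (n : ℂ) * fourierCoeff (f : Torus → ℂ) n) 2 := by
  refine memℓp_gen ?_
  refine Summable.of_nonneg_of_le (fun n => by positivity) (fun n => ?_) hf
  simp only [sobolevTerm, Real.rpow_one, norm_mul, ENNReal.toReal_ofNat, Real.rpow_ofNat, mul_pow,
    Complex.norm_intCast, sq_abs]
  gcongr
  linarith

/-- `D f = -i ∂ₓ f` for `f ∈ H¹(𝕋)`: the function with Fourier coefficients `n f̂(n)`. -/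
def derivL2 : sobolev 1 →ₗ[ℂ] L2T where
  toFun f := (fourierBasis (T := 2 * Real.pi)).repr.symm ⟨_, memlp_deriv f.2⟩
  map_add' f g := by
    rw [← map_add]
    congr 1
    ext n
    exact (congrArg _ (fourierCoeff_L2_add f.1 g.1 n)).trans (mul_add _ _ _)
  map_smul' c f := by
    rw [RingHom.id_apply, ← map_smul]
    congr 1
    ext n
    exact (congrArg _ (fourierCoeff_L2_smul c f.1 n)).trans (mul_left_comm _ _ _)

theorem fourierCoeff_derivL2 (f : sobolev 1) (n : ℤ) :
    fourierCoeff (derivL2 f : Torus → ℂ) n = n * fourierCoeff ((f : L2T) : Torus → ℂ) n := by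
  rw [← repr_eq_fourierCoeff]
  simp [derivL2]

theorem derivL2_mem_hardy {f : L2T} (hf : f ∈ sobolev 1) (hf' : f ∈ hardy) :
    derivL2 ⟨f, hf⟩ ∈ hardy := by
  intro n hn
  rw [fourierCoeff_derivL2, hf' n hn, mul_zero]

/-- The operator `D` on `L²₊(𝕋)`, with domain `H¹₊(𝕋)`. -/
def derivHardy : hardySobolev 1 →ₗ[ℂ] hardy :=
  (derivL2 ∘ₗ hardy.subtype.submoduleComap (sobolev 1)).codRestrict hardy
    fun f => derivL2_mem_hardy f.2 f.1.2

/-- Multiplication by a bounded function `b` on `L²(𝕋)`. -/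
def mulOp (b : LinfT) : L2T →L[ℂ] L2T :=
  (ContinuousLinearMap.mul ℂ ℂ).holderL (haarAddCircle : Measure Torus) ∞ 2 2 b

theorem coeFn_mulOp (b : LinfT) (f : L2T) :
    (mulOp b f : Torus → ℂ) =ᵐ[haarAddCircle] fun x => b x * f x :=
  (ContinuousLinearMap.mul ℂ ℂ).coeFn_holder b f

/-- The Toeplitz operator `T_b f = Π(b f)` on `L²₊(𝕋)`. -/
def toeplitz (b : LinfT) : hardy →L[ℂ] hardy := szego ∘L mulOp b ∘L hardy.subtypeL

/-- The Lax operator `L_u = D - T_u T_{ū}` on `L²₊(𝕋)`, with domain `H¹₊(𝕋)`. -/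
def laxOp (u : LinfT) : hardy →ₗ.[ℂ] hardy where
  domain := hardySobolev 1
  toFun := derivHardy
    - (toeplitz u ∘L toeplitz (star u)).toLinearMap ∘ₗ (hardySobolev 1).subtype

/-- The function `x ↦ e^{ix}`. -/
def expI : LinfT := fourierLp ∞ 1

theorem fourierCoeff_mulOp_expI (f : L2T) (n : ℤ) :
    fourierCoeff (mulOp expI f : Torus → ℂ) n = fourierCoeff (f : Torus → ℂ) (n - 1) := by
  unfold fourierCoeff
  refine integral_congr_ae ?_
  filter_upwards [coeFn_mulOp expI f, coeFn_fourierLp (T := 2 * Real.pi) ∞ 1] with x h1 h2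
  rw [h1, show expI x = fourier 1 x from h2, show -(n - 1) = -n + 1 by ring, fourier_add]
  simp only [smul_eq_mul]
  ring

theorem mulOp_expI_mem_hardy (h : hardy) : mulOp expI h ∈ hardy := by
  intro n hn
  rw [fourierCoeff_mulOp_expI]
  exact h.2 _ (by omega)

/-- The shift operator `S h = e^{ix} h` on `L²₊(𝕋)`. -/
def shift : hardy →L[ℂ] hardy :=
  (mulOp expI ∘L hardy.subtypeL).codRestrict hardy mulOp_expI_mem_hardy

/-- `W τ = e^{iτA}` for all `τ ∈ ℝ`: `W` is the strongly continuous one-parameter unitary group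
with infinitesimal generator `iA` (domain included). -/
structure IsUnitaryGroupOf {H : Type*} [NormedAddCommGroup H] [InnerProductSpace ℂ H]
    [CompleteSpace H] (A : H →ₗ.[ℂ] H) (W : ℝ → H →L[ℂ] H) : Prop where
  unitary : ∀ τ, W τ ∈ unitary (H →L[ℂ] H)
  zero : W 0 = 1
  add : ∀ σ τ, W (σ + τ) = W σ * W τ
  continuous : ∀ x, Continuous fun τ => W τ x
  generator : ∀ x y, (x, y) ∈ A.graph ↔ HasDerivAt (fun τ => W τ x) (Complex.I • y) 0

/-! ### The equation -/

/-- `w = D₊ g = D Π g`, for a function `g` on the torus and `w ∈ L²(𝕋)`, expressed on the Fourier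
coefficients (which determine `w`). -/
def IsDPlus (g : Torus → ℂ) (w : L2T) : Prop :=
  ∀ n : ℤ, fourierCoeff (w : Torus → ℂ) n = if 0 ≤ n then (n : ℂ) * fourierCoeff g n else 0

/-- `u ∈ C(I, H^s₊(𝕋))` solves `i ∂ₜu + ∂ₓ²u + 2 D₊(|u|²) u = 0` on the time interval `I`.

The equation is meant in the sense of distributions, as `∂ₓ²u` is only in `H^{s-2}`:
every Fourier coefficient is differentiable in time (one-sidedly at an end point of `I`) and
`i ∂ₜû(n) - n² û(n) + 2 (D₊(|u|²) u)^(n) = 0`.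
For `s > 3/2`, `D₊(|u|²)` is in `H^{s-1}`, hence in `L²`, so that `w` always exists. -/
structure IsSolution (s : ℝ) (I : Set ℝ) (u : ℝ → hardy) : Prop where
  mem : ∀ t ∈ I, u t ∈ hardySobolev s
  continuous : ∀ t₀ ∈ I,
    Filter.Tendsto (fun t => sobolevNorm s ((u t - u t₀ : hardy) : L2T)) (𝓝[I] t₀) (𝓝 0)
  equation : ∀ t ∈ I, ∃ w : L2T,
    IsDPlus (fun x => ((‖(u t : L2T) x‖ ^ 2 : ℝ) : ℂ)) w ∧
    ∀ n : ℤ, ∃ d : ℂ,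
      HasDerivWithinAt (fun τ => fourierCoeff ((u τ : L2T) : Torus → ℂ) n) d I t ∧
      Complex.I * d - (n : ℂ) ^ 2 * fourierCoeff ((u t : L2T) : Torus → ℂ) n
        + 2 * fourierCoeff (fun x => w x * (u t : L2T) x) n = 0

end CalogeroSutherland

end

/-!
The equation has a Lax pair. With `K = T_u`, so that `K* = T_ū`, and `N = T_{Du}`, put
`L = D - K K*` and `B = -i (K N* + N K*) + i (K K*)²`; `B` is bounded and skew-adjoint. Along a
solution `∂ₜL = [B, L]`, and the equation itself reads `∂ₜu = B u - i L² u`. Hence the propagator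
`U` of `B` is unitary, `L_{u(t)} = U L_{u₀} U*`, and `U* u(t) = e^{-itL²} u₀`, where `L = L_{u₀}`.
Since `B 1 = i L² 1`, also `U* 1 = e^{-itL²} 1`. Finally the commutators of the backward shift `S*`
with `L` and `B` are explicit: the first is `S*` up to a rank one operator, the second has rank two.
They combine so that on the eigenvectors `b_i` of `L` the matrix of `X = U* S* U` satisfies
`∂ₜX_{ji} = -i ((λ_j + 1)² - λ_i²) X_{ji}`
(`IsSymbol.inner_laxB_shift_adjoint`). Thus `V = U e^{-itL²}` fixes `1`, sends `u₀` to `u(t)`, and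
`S* V = V Y` with `Y = e^{-it} e^{-2itL} S*`, so that the `k`-th Fourier coefficient of `u(t)` is
`⟨1, (S*)ᵏ u(t)⟩ = ⟨1, Yᵏ u₀⟩` (`IsFlow.inner_basis_eq`). As `Y` is a contraction, summing the
Neumann series of `(1 - z Y)⁻¹` gives the formula (`IsFlow.isUnit_and_hasSum`).

The operator `L` is self-adjoint with compact resolvent
`(L + ρ)⁻¹ = (D + ρ)⁻¹ (1 - K K* (D + ρ)⁻¹)⁻¹`, `ρ` large, so it is diagonal in a Hilbert basis
(`exists_eigenbasis_isLax`). This gives the group `e^{iτL}` and its uniqueness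
(`existsUnique_unitaryGroup_of_eigenbasis`), and reduces the unbounded operators in the argument to
scalars: every differential equation in which they occur is solved for an inner product with
eigenvectors.

The solution is only differentiable coefficient by coefficient. The Lax equation is first checked
on the entries `⟨K* e_m, K* e_n⟩`, which are finite sums in the Fourier coefficients of `u`
(`IsSymbol.laxEquation_basis`), then upgraded to norm differentiability of
`(D + ρ)⁻¹ K K* (D + ρ)⁻¹`, whose weak derivative is norm continuous, and so of the resolvent
(`IsFlow.hasDerivWithinAt_laxResolvent`); that `U` conjugates the Lax operators follows. The only
facts on `H^s`, `s > 3/2`, in use are that `u` and `D u` are bounded and depend continuously on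
time in `L^∞`.
-/

set_option linter.unusedSectionVars false

noncomputable section

namespace CalogeroSutherland

/-! ### Linear differential equations in a Banach algebra -/

section LinearODE

variable {A : Type*} [NormedRing A] [NormedAlgebra ℝ A] [CompleteSpace A]

/-- The `n`-th term of the Dyson series of `U' = B U`, `U 0 = 1`: the `n`-fold iterated integral
of `B`. -/
def dysonTerm (B : ℝ → A) : ℕ → ℝ → A
  | 0 => fun _ => 1
  | n + 1 => fun t => ∫ τ in (0 : ℝ)..t, B τ * dysonTerm B n τ

theorem continuous_dysonTerm {B : ℝ → A} (hB : Continuous B) (n : ℕ) :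
    Continuous (dysonTerm B n) := by
  induction n with
  | zero => exact continuous_const
  | succ n ih =>
    exact intervalIntegral.continuous_primitive
      (fun a b => (hB.mul ih).intervalIntegrable a b) 0

theorem hasDerivAt_dysonTerm_succ {B : ℝ → A} (hB : Continuous B) (n : ℕ) (t : ℝ) :
    HasDerivAt (dysonTerm B (n + 1)) (B t * dysonTerm B n t) t :=
  intervalIntegral.integral_hasDerivAt_right
    ((hB.mul (continuous_dysonTerm hB n)).intervalIntegrable _ _)
    ((hB.mul (continuous_dysonTerm hB n)).stronglyMeasurableAtFilter _ _)
    (hB.mul (continuous_dysonTerm hB n)).continuousAt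

theorem norm_dysonTerm_le {B : ℝ → A} (hB : Continuous B) {C : ℝ} (hC : ∀ t, ‖B t‖ ≤ C)
    (n : ℕ) (t : ℝ) :
    ‖dysonTerm B n t‖ ≤ ‖(1 : A)‖ * ((C * |t|) ^ n / n.factorial) := by
  have hC0 : 0 ≤ C := (norm_nonneg _).trans (hC 0)
  induction n generalizing t with
  | zero => simp [dysonTerm]
  | succ n ih =>
    have hcont := continuous_dysonTerm hB n
    calc ‖dysonTerm B (n + 1) t‖
        ≤ ∫ τ in Set.uIoc 0 t, ‖B τ * dysonTerm B n τ‖ :=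
          intervalIntegral.norm_integral_le_integral_norm_uIoc
      _ ≤ ∫ τ in Set.uIoc 0 t,
            (C * (‖(1 : A)‖ * (C ^ n / n.factorial))) * |τ - 0| ^ n := by
          refine setIntegral_mono_on ?_ ?_ measurableSet_uIoc fun τ _ => ?_
          · exact ((hB.mul hcont).norm.intervalIntegrable 0 t).def'
          · exact ((by fun_prop : Continuous fun τ : ℝ =>
              (C * (‖(1 : A)‖ * (C ^ n / n.factorial))) * |τ - 0| ^ n).intervalIntegrable 0 t).def'
          · calc ‖B τ * dysonTerm B n τ‖ ≤ ‖B τ‖ * ‖dysonTerm B n τ‖ := norm_mul_le _ _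
              _ ≤ C * (‖(1 : A)‖ * ((C * |τ|) ^ n / n.factorial)) := by
                  gcongr
                  · exact hC τ
                  · exact ih τ
              _ = _ := by rw [sub_zero, mul_pow]; ring
      _ = ‖(1 : A)‖ * ((C * |t|) ^ (n + 1) / (n + 1).factorial) := by
          rw [integral_const_mul, integral_pow_abs_sub_uIoc, sub_zero, mul_pow, Nat.factorial_succ]
          push_cast
          field_simp
          ring

/-- A linear differential equation with bounded continuous coefficient in a Banach algebra has a
global solution, the sum of its Dyson series. -/
theorem exists_linearODE_solution {B : ℝ → A} (hB : Continuous B) {C : ℝ}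
    (hC : ∀ t, ‖B t‖ ≤ C) :
    ∃ U : ℝ → A, U 0 = 1 ∧ ∀ t, HasDerivAt U (B t * U t) t := by
  have hC0 : 0 ≤ C := (norm_nonneg _).trans (hC 0)
  have hbound : ∀ t : ℝ, Summable fun n : ℕ => ‖(1 : A)‖ * ((C * |t|) ^ n / n.factorial) :=
    fun t => (Real.summable_pow_div_factorial (C * |t|)).mul_left _
  have hsum : ∀ t, Summable fun n => dysonTerm B n t := fun t =>
    Summable.of_norm_bounded (hbound t) fun n => norm_dysonTerm_le hB hC n t
  refine ⟨fun t => ∑' n, dysonTerm B n t, ?_, fun t => ?_⟩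
  · have h0 : ∀ n ≠ 0, dysonTerm B n 0 = 0 := fun n hn => by
      obtain ⟨m, rfl⟩ := Nat.exists_eq_succ_of_ne_zero hn
      exact intervalIntegral.integral_same
    exact tsum_eq_single 0 h0
  · have ht : 0 ≤ |t| + 1 := by positivity
    have hu : Summable fun n : ℕ => C * (‖(1 : A)‖ * ((C * (|t| + 1)) ^ n / n.factorial)) := by
      have := hbound (|t| + 1)
      rw [abs_of_nonneg ht] at this
      exact this.mul_left C
    have h0 : Summable fun n => dysonTerm B (n + 1) 0 := (summable_nat_add_iff 1).2 (hsum 0)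
    have key : HasDerivAt (fun z => ∑' n, dysonTerm B (n + 1) z)
        (∑' n, B t * dysonTerm B n t) t := by
      refine hasDerivAt_tsum_of_isPreconnected (t := Metric.ball (0 : ℝ) (|t| + 1)) (y₀ := 0)
        (g' := fun n t => B t * dysonTerm B n t) hu
        Metric.isOpen_ball (convex_ball _ _).isPreconnected
        (fun n y _ => hasDerivAt_dysonTerm_succ hB n y) (fun n y hy => ?_)
        (Metric.mem_ball_self (by positivity)) h0 (by simp)
      have hy' : |y| ≤ |t| + 1 := by simpa using (Metric.mem_ball.1 hy).le
      refine (norm_mul_le _ _).trans ?_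
      gcongr
      · exact hC y
      · refine (norm_dysonTerm_le hB hC n y).trans ?_
        gcongr
    rw [(hsum t).tsum_mul_left] at key
    have h2 : ∀ z, ∑' n, dysonTerm B n z = 1 + ∑' n, dysonTerm B (n + 1) z := fun z =>
      (hsum z).tsum_eq_zero_add
    exact (key.const_add 1).congr_of_eventuallyEq (Filter.Eventually.of_forall h2)

end LinearODE

section HilbertSpace

variable {H : Type*} [NormedAddCommGroup H] [InnerProductSpace ℂ H] [CompleteSpace H]

open ContinuousLinearMap

theorem hasDerivAt_star {U : ℝ → H →L[ℂ] H} {U' : H →L[ℂ] H} {t : ℝ} (h : HasDerivAt U U' t) :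
    HasDerivAt (fun t => star (U t)) (star U') t :=
  (starL' ℝ : (H →L[ℂ] H) ≃L[ℝ] (H →L[ℂ] H)).toContinuousLinearMap.hasFDerivAt.comp_hasDerivAt t h

/-- The propagator of `U' = B U` is unitary when `B` is skew-adjoint. -/
theorem exists_unitary_propagator {B : ℝ → H →L[ℂ] H} (hB : Continuous B) {C : ℝ}
    (hC : ∀ t, ‖B t‖ ≤ C) (hskew : ∀ t, star (B t) = -B t) :
    ∃ U : ℝ → H →L[ℂ] H, U 0 = 1 ∧ (∀ t, HasDerivAt U (B t * U t) t) ∧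
      ∀ t, U t ∈ unitary (H →L[ℂ] H) := by
  obtain ⟨U, h0, hU⟩ := exists_linearODE_solution hB hC
  have hUs : ∀ t, HasDerivAt (fun t => star (U t)) (-(star (U t) * B t)) t := fun t => by
    have := hasDerivAt_star (hU t)
    rwa [star_mul, hskew, mul_neg] at this
  refine ⟨U, h0, hU, fun t => Unitary.mem_iff.2 ⟨?_, ?_⟩⟩
  · have hd : ∀ t, HasDerivAt (fun t => star (U t) * U t) 0 t := fun t => by
      refine ((hUs t).mul (hU t)).congr_deriv ?_
      noncomm_ring
    have := is_const_of_deriv_eq_zero (fun t => (hd t).differentiableAt)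
      (fun t => (hd t).deriv) t 0
    simpa [h0] using this
  · -- `U U*` solves the linear equation `E' = [B, E]`, as does the constant `1`.
    have hC0 : 0 ≤ C := (norm_nonneg _).trans (hC 0)
    have := ODE_solution_unique_univ (K := ⟨2 * C, by positivity⟩) (t₀ := 0)
      (v := fun t E => B t * E - E * B t)
      (s := fun _ => Set.univ) (f := fun t => U t * star (U t)) (g := fun _ => 1) (fun t => ?_)
      (fun t => ⟨?_, trivial⟩) (fun t => ⟨?_, trivial⟩) (by simp [h0])
    · exact congrFun this t
    · refine LipschitzOnWith.of_dist_le_mul fun x _ y _ => ?_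
      rw [dist_eq_norm, dist_eq_norm,
        show B t * x - x * B t - (B t * y - y * B t) = B t * (x - y) - (x - y) * B t by
          noncomm_ring]
      refine (norm_sub_le _ _).trans ((add_le_add (norm_mul_le _ _) (norm_mul_le _ _)).trans ?_)
      have h1 := mul_le_mul_of_nonneg_right (hC t) (norm_nonneg (x - y))
      change _ ≤ 2 * C * _
      nlinarith
    · refine ((hU t).mul (hUs t)).congr_deriv ?_
      noncomm_ring
    · simpa using hasDerivAt_const t (1 : H →L[ℂ] H)

/-! ### Hilbert bases and diagonal operators -/

section Basis

variable {ι : Type*} (b : HilbertBasis ι ℂ H)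

theorem _root_.HilbertBasis.ext_inner {x y : H}
    (h : ∀ i, inner ℂ (b i) x = inner ℂ (b i) y) : x = y := by
  refine b.repr.injective (lp.ext (funext fun i => ?_))
  rw [b.repr_apply_apply, b.repr_apply_apply, h i]

theorem _root_.HilbertBasis.ext_clm {S T : H →L[ℂ] H} (h : ∀ i, S (b i) = T (b i)) : S = T := by
  refine ContinuousLinearMap.ext_on (s := Set.range b) ?_ ?_
  · rw [Submodule.dense_iff_topologicalClosure_eq_top]; exact b.dense_span
  · rintro _ ⟨i, rfl⟩; exact h i

theorem _root_.HilbertBasis.hasSum_norm_inner_sq (x : H) :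
    HasSum (fun i => ‖inner ℂ (b i) x‖ ^ 2) (‖x‖ ^ 2) := by
  have h := Complex.reCLM.hasSum (b.hasSum_inner_mul_inner x x)
  rw [inner_self_eq_norm_sq_to_K] at h
  convert h using 1
  · funext i
    change _ = (inner ℂ x (b i) * inner ℂ (b i) x).re
    rw [← inner_conj_symm x (b i), RCLike.conj_mul]
    norm_cast
  · norm_cast

theorem _root_.HilbertBasis.norm_le_of_inner {x y : H} {C : ℝ} (hC : 0 ≤ C)
    (h : ∀ i, ‖inner ℂ (b i) y‖ ≤ C * ‖inner ℂ (b i) x‖) : ‖y‖ ≤ C * ‖x‖ := by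
  have := hasSum_le (fun i => ?_) (b.hasSum_norm_inner_sq y)
    ((b.hasSum_norm_inner_sq x).mul_left (C ^ 2))
  · rw [← mul_pow] at this
    exact (pow_le_pow_iff_left₀ (norm_nonneg _) (by positivity) two_ne_zero).1 this
  · rw [← mul_pow]
    exact pow_le_pow_left₀ (norm_nonneg _) (h i) 2

theorem _root_.HilbertBasis.inner_self_ite [DecidableEq ι] (i j : ι) :
    inner ℂ (b i) (b j) = if i = j then 1 else 0 :=
  orthonormal_iff_ite.1 b.orthonormal i j

/-- Bounded sequences act on a Hilbert space by diagonal operators. -/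
theorem _root_.HilbertBasis.exists_diagonal (c : ι → ℂ) {C : ℝ} (hC : 0 ≤ C) (hc : ∀ i, ‖c i‖ ≤ C) :
    ∃ T : H →L[ℂ] H, (∀ x i, inner ℂ (b i) (T x) = c i * inner ℂ (b i) x) ∧ ‖T‖ ≤ C := by
  have hmem : ∀ x, Memℓp (fun i => c i * inner ℂ (b i) x) 2 := fun x => by
    refine memℓp_gen ?_
    refine Summable.of_nonneg_of_le (fun i => by positivity) (fun i => ?_)
      ((b.hasSum_norm_inner_sq x).summable.mul_left (C ^ 2))
    simp only [norm_mul, ENNReal.toReal_ofNat, Real.rpow_ofNat, mul_pow]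
    gcongr
    exact hc i
  let f : H → H := fun x => b.repr.symm ⟨_, hmem x⟩
  have hf : ∀ x i, inner ℂ (b i) (f x) = c i * inner ℂ (b i) x := fun x i => by
    rw [← b.repr_apply_apply, LinearIsometryEquiv.apply_symm_apply]
  let F : H →ₗ[ℂ] H :=
    { toFun := f
      map_add' := fun x y => b.ext_inner fun i => by
        rw [inner_add_right, hf, hf, hf, inner_add_right, mul_add]
      map_smul' := fun a x => b.ext_inner fun i => by
        rw [RingHom.id_apply, inner_smul_right, hf, hf, inner_smul_right]; ring }
  have hb : ∀ x, ‖F x‖ ≤ C * ‖x‖ := fun x => b.norm_le_of_inner hC fun i => by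
    rw [show inner ℂ (b i) (F x) = _ from hf x i, norm_mul]
    exact mul_le_mul_of_nonneg_right (hc i) (norm_nonneg _)
  exact ⟨F.mkContinuous C hb, hf, F.mkContinuous_norm_le hC hb⟩

theorem _root_.HilbertBasis.diagonal_apply {c : ι → ℂ} {T : H →L[ℂ] H}
    (hT : ∀ x i, inner ℂ (b i) (T x) = c i * inner ℂ (b i) x) (i : ι) : T (b i) = c i • b i := by
  classical
  refine b.ext_inner fun j => ?_
  rw [hT, inner_smul_right, b.inner_self_ite]
  split_ifs with h
  · rw [h]
  · simp

/-- A diagonal operator whose entries tend to zero is compact. -/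
theorem _root_.HilbertBasis.isCompactOperator_diagonal (e : HilbertBasis ℕ ℂ H) {c : ℕ → ℂ}
    (hc : Filter.Tendsto c Filter.atTop (𝓝 0)) {T : H →L[ℂ] H}
    (hT : ∀ x i, inner ℂ (e i) (T x) = c i * inner ℂ (e i) x) : IsCompactOperator T := by
  let F : ℕ → H →L[ℂ] H := fun N =>
    ∑ n ∈ Finset.range N, (toSpanSingleton ℂ (c n • e n)) ∘L (innerSL ℂ (e n))
  have hF : ∀ N x i, inner ℂ (e i) (F N x) = if i < N then c i * inner ℂ (e i) x else 0 := by
    intro N x i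
    have : F N x = ∑ n ∈ Finset.range N, (inner ℂ (e n) x) • c n • e n := by
      simp [F, toSpanSingleton_apply]
    rw [this, inner_sum]
    simp only [inner_smul_right, e.inner_self_ite, mul_ite, mul_one, mul_zero]
    rw [Finset.sum_ite_eq]
    simp only [Finset.mem_range, mul_comm]
  refine isCompactOperator_of_tendsto (l := Filter.atTop) (F := F) ?_ (Filter.Eventually.of_forall
    fun N => ?_)
  · rw [Metric.tendsto_atTop]
    intro ε hε
    obtain ⟨N, hN⟩ := Metric.tendsto_atTop.1 hc (ε / 2) (by positivity)
    refine ⟨N, fun M hM => ?_⟩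
    rw [dist_eq_norm]
    refine lt_of_le_of_lt (opNorm_le_bound _ (by positivity : 0 ≤ ε / 2) fun x => ?_)
      (half_lt_self hε)
    refine e.norm_le_of_inner (by positivity) fun i => ?_
    rw [sub_apply, inner_sub_right, hF, hT]
    split_ifs with h
    · rw [sub_self, norm_zero]; positivity
    · rw [zero_sub, norm_neg, norm_mul]
      gcongr
      simpa using (hN i (by omega)).le
  · change IsCompactOperator (F N)
    refine Submodule.sum_mem (compactOperator (RingHom.id ℂ) H H) fun n _ => ?_
    have hn : IsCompactOperator (toSpanSingleton ℂ (c n • e n)) :=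
      isCompactOperator_of_locallyCompactSpace_rng _
    exact IsCompactOperator.comp_clm hn (innerSL ℂ (e n))

/-- An injective compact self-adjoint operator has a Hilbert basis of eigenvectors, with nonzero
real eigenvalues. -/
theorem exists_hilbertBasis_eigenvectors.{v} {H : Type v} [NormedAddCommGroup H]
    [InnerProductSpace ℂ H] [CompleteSpace H] {R : H →L[ℂ] H} (hc : IsCompactOperator R)
    (hs : (R : H →ₗ[ℂ] H).IsSymmetric) (hinj : ∀ x, R x = 0 → x = 0) :
    ∃ (ι : Type v) (b : HilbertBasis ι ℂ H) (μ : ι → ℝ),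
      (∀ i, μ i ≠ 0) ∧ ∀ i, R (b i) = (μ i : ℂ) • b i := by
  let E : ℂ → Submodule ℂ H := fun μ => Module.End.eigenspace (R : H →ₗ[ℂ] H) μ
  have hE : ∀ μ, IsClosed (E μ : Set H) := fun μ => by
    have : (E μ : Set H) = {x | R x = μ • x} := by
      ext x
      simp [E]
    rw [this]
    exact isClosed_eq R.continuous (continuous_const_smul μ)
  have : ∀ μ, CompleteSpace (E μ) := fun μ => (hE μ).completeSpace_coe
  choose w v hv using fun μ => exists_hilbertBasis ℂ (E μ)
  have ho : Orthonormal ℂ fun a : Σ μ, w μ => ((v a.1 a.2 : E a.1) : H) :=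
    (hs.orthogonalFamily_eigenspaces).orthonormal_sigma_orthonormal fun μ => (v μ).orthonormal
  have hmem : ∀ a : Σ μ, w μ, R (v a.1 a.2 : E a.1) = a.1 • ((v a.1 a.2 : E a.1) : H) := fun a =>
    Module.End.mem_eigenspace_iff.1 (v a.1 a.2).2
  have hsp : (Submodule.span ℂ (Set.range fun a : Σ μ, w μ => ((v a.1 a.2 : E a.1) : H)))ᗮ = ⊥ := by
    rw [eq_bot_iff, ← ContinuousLinearMap.orthogonalComplement_iSup_eigenspaces_eq_bot hc hs]
    intro x hx
    rw [Submodule.mem_orthogonal] at hx ⊢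
    intro y hy
    refine Submodule.iSup_induction _ (motive := fun y => inner ℂ y x = 0) hy (fun μ y hy => ?_)
      (inner_zero_left _) (fun y z hy hz => by rw [inner_add_left, hy, hz, add_zero])
    have h1 := (v μ).hasSum_repr ⟨y, hy⟩
    have h2 := (E μ).subtypeL.hasSum h1
    have h3 : HasSum (fun i => inner ℂ (((v μ).repr ⟨y, hy⟩ i • v μ i : E μ) : H) x)
        (inner ℂ y x) := by
      have := ((innerSL ℂ x).hasSum h2).star
      simpa [Function.comp_def, ← starRingEnd_apply, mul_comm] using this
    refine h3.unique ?_
    convert hasSum_zero with i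
    rw [Submodule.coe_smul, inner_smul_left, hx _ (Submodule.subset_span ⟨⟨μ, i⟩, rfl⟩), mul_zero]
  let b := HilbertBasis.mkOfOrthogonalEqBot ho hsp
  have hb : ∀ a, b a = ((v a.1 a.2 : E a.1) : H) := fun a => by
    rw [HilbertBasis.coe_mkOfOrthogonalEqBot]
  have hne : ∀ a, b a ≠ 0 := fun a => b.orthonormal.ne_zero a
  have hreal : ∀ a : Σ μ, w μ, (a.1.re : ℂ) = a.1 := fun a => by
    refine Complex.conj_eq_iff_re.1 (hs.conj_eigenvalue_eq_self (μ := a.1) ?_)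
    exact Module.End.hasEigenvalue_of_hasEigenvector ⟨(v a.1 a.2).2, by rw [← hb]; exact hne a⟩
  refine ⟨Σ μ, w μ, b, fun a => a.1.re, fun a h => hne a (hinj _ ?_), fun a => ?_⟩
  · have h0 : a.1 = 0 := by rw [← hreal]; exact congrArg Complex.ofReal h
    rw [hb, hmem]
    exact smul_eq_zero_of_left h0 _
  · rw [hreal, hb, hmem]

end Basis

end HilbertSpace

/-! ### From weak to strong derivatives -/

theorem eq_of_hasDerivWithinAt_zero {E : Type*} [NormedAddCommGroup E] [NormedSpace ℝ E]
    {J : Set ℝ} (hJ : Convex ℝ J) {f : ℝ → E} (hf : ∀ t ∈ J, HasDerivWithinAt f 0 J t)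
    {r t : ℝ} (hr : r ∈ J) (ht : t ∈ J) : f t = f r := by
  have := hJ.norm_image_sub_le_of_norm_hasDerivWithin_le (C := 0) hf (by simp) hr ht
  rwa [zero_mul, norm_le_zero_iff, sub_eq_zero] at this

/-- If a separating family of continuous functionals differentiates `f` to a continuous function
`f'`, then `f` is differentiable in norm, with derivative `f'`. -/
theorem hasDerivWithinAt_of_weak {E κ : Type*} [NormedAddCommGroup E] [NormedSpace ℝ E]
    [CompleteSpace E] {J : Set ℝ} (hJ : Convex ℝ J) {f f' : ℝ → E} (hf' : Continuous f')
    (φ : κ → E →L[ℝ] ℂ) (hφ : ∀ x, (∀ k, φ k x = 0) → x = 0)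
    (h : ∀ k, ∀ t ∈ J, HasDerivWithinAt (fun τ => φ k (f τ)) (φ k (f' t)) J t)
    {t : ℝ} (ht : t ∈ J) : HasDerivWithinAt f (f' t) J t := by
  let F : ℝ → E := fun τ => ∫ σ in t..τ, f' σ
  have hF : ∀ τ, HasDerivAt F (f' τ) τ := fun τ =>
    intervalIntegral.integral_hasDerivAt_right (hf'.intervalIntegrable _ _)
      (hf'.stronglyMeasurableAtFilter _ _) hf'.continuousAt
  have hFt : F t = 0 := intervalIntegral.integral_same
  have key : ∀ τ ∈ J, f τ = f t + F τ := fun τ hτ => by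
    refine sub_eq_zero.1 (hφ _ fun k => ?_)
    have := eq_of_hasDerivWithinAt_zero hJ (f := fun τ => φ k (f τ) - φ k (F τ))
      (fun σ hσ => ((h k σ hσ).sub
        ((φ k).hasFDerivAt.comp_hasDerivAt σ (hF σ)).hasDerivWithinAt).congr_deriv (sub_self _))
      ht hτ
    simp only [hFt, map_zero, sub_zero] at this
    rw [map_sub, map_add, ← this]
    ring
  exact (((hF t).const_add (f t)).hasDerivWithinAt).congr key (key t ht)

section HilbertSpace

variable {H : Type*} [NormedAddCommGroup H] [InnerProductSpace ℂ H] [CompleteSpace H]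

open ContinuousLinearMap

theorem clm_mul_apply (S T : H →L[ℂ] H) (x : H) : (S * T) x = S (T x) := rfl

theorem clm_one_apply (x : H) : (1 : H →L[ℂ] H) x = x := rfl

/-- The real-linear coordinate functional of a Hilbert basis. -/
def coordFunctional {ι : Type*} (b : HilbertBasis ι ℂ H) (i : ι) : H →L[ℝ] ℂ :=
  (innerSL ℂ (b i)).restrictScalars ℝ

theorem coordFunctional_apply {ι : Type*} (b : HilbertBasis ι ℂ H) (i : ι) (x : H) :
    coordFunctional b i x = inner ℂ (b i) x := rfl

theorem coordFunctional_separating {ι : Type*} (b : HilbertBasis ι ℂ H) (x : H)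
    (hx : ∀ i, coordFunctional b i x = 0) : x = 0 :=
  b.ext_inner fun i => by rw [inner_zero_right]; exact hx i

/-- A uniformly bounded family of operators that is strongly continuous on a Hilbert basis is
strongly continuous. -/
theorem continuous_apply_of_basis {ι : Type*} (b : HilbertBasis ι ℂ H) {W : ℝ → H →L[ℂ] H} {C : ℝ}
    (hW : ∀ τ, ‖W τ‖ ≤ C) (h : ∀ i, Continuous fun τ => W τ (b i)) (x : H) :
    Continuous fun τ => W τ x := by
  have hspan : ∀ y ∈ Submodule.span ℂ (Set.range b), Continuous fun τ => W τ y := by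
    intro y hy
    induction hy using Submodule.span_induction with
    | mem y hy => obtain ⟨i, rfl⟩ := hy; exact h i
    | zero => simpa using continuous_const
    | add y z _ _ hy hz => simp only [map_add]; exact hy.add hz
    | smul a y _ hy => simp only [map_smul]; exact hy.const_smul a
  have hC : 0 ≤ C := (norm_nonneg _).trans (hW 0)
  refine continuous_of_uniform_approx_of_continuous fun u hu => ?_
  obtain ⟨ε, hε, hu⟩ := Metric.mem_uniformity_dist.1 hu
  have hx : x ∈ closure (Submodule.span ℂ (Set.range b) : Set H) := by
    rw [← Submodule.topologicalClosure_coe, b.dense_span]; trivial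
  obtain ⟨y, hy, hxy⟩ := Metric.mem_closure_iff.1 hx (ε / (C + 1)) (by positivity)
  refine ⟨_, hspan y hy, fun τ => hu ?_⟩
  rw [dist_eq_norm, ← map_sub]
  rw [dist_eq_norm, lt_div_iff₀ (by positivity)] at hxy
  calc ‖W τ (x - y)‖ ≤ C * ‖x - y‖ := (W τ).le_of_opNorm_le (hW τ) _
    _ ≤ ‖x - y‖ * (C + 1) := by nlinarith [norm_nonneg (x - y)]
    _ < ε := hxy

/-! ### Unitary groups with an eigenbasis -/

section Group

variable {ι : Type*} (b : HilbertBasis ι ℂ H) {A : H →ₗ.[ℂ] H} {lam : ι → ℝ}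

theorem hasDerivAt_cexp_mul_I (a τ : ℝ) :
    HasDerivAt (fun τ : ℝ => Complex.exp (Complex.I * τ * a))
      (Complex.I * a * Complex.exp (Complex.I * τ * a)) τ := by
  have h := ((((hasDerivAt_id τ).ofReal_comp).const_mul Complex.I).mul_const (a : ℂ)).cexp
  simp only [id] at h
  refine h.congr_deriv ?_
  push_cast
  ring

theorem norm_cexp_I_mul (τ a : ℝ) : ‖Complex.exp (Complex.I * τ * a)‖ = 1 := by
  rw [show Complex.I * τ * a = ((τ * a : ℝ) : ℂ) * Complex.I by push_cast; ring,
    Complex.norm_exp_ofReal_mul_I]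

/-- A diagonal operator with unimodular entries is unitary. -/
theorem _root_.HilbertBasis.diagonal_mem_unitary {c : ι → ℂ} (hc : ∀ i, ‖c i‖ = 1) {T : H →L[ℂ] H}
    (hT : ∀ x i, inner ℂ (b i) (T x) = c i * inner ℂ (b i) x) : T ∈ unitary (H →L[ℂ] H) := by
  have hs : ∀ x i, inner ℂ (b i) (star T x) = conj (c i) * inner ℂ (b i) x := fun x i => by
    rw [star_eq_adjoint, adjoint_inner_right, b.diagonal_apply hT, inner_smul_left]
  have hcc : ∀ i, conj (c i) * c i = 1 := fun i => by
    rw [RCLike.conj_mul, hc i]; norm_num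
  refine Unitary.mem_iff.2 ⟨?_, ?_⟩ <;>
    refine ContinuousLinearMap.ext fun x => b.ext_inner fun i => ?_
  · rw [clm_mul_apply, hs, hT, ← mul_assoc, hcc, one_mul, clm_one_apply]
  · rw [clm_mul_apply, hT, hs, ← mul_assoc, mul_comm (c i), hcc, one_mul, clm_one_apply]

/-- An operator which is diagonal, with maximal domain, in a Hilbert basis of eigenvectors
generates a unitary group. -/
theorem exists_unitaryGroup_of_eigenbasis
    (hA : ∀ x y, (x, y) ∈ A.graph ↔ ∀ i, inner ℂ (b i) y = lam i * inner ℂ (b i) x) :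
    ∃ W, IsUnitaryGroupOf A W := by
  choose W hW hWn using fun τ : ℝ => b.exists_diagonal
    (fun i => Complex.exp (Complex.I * τ * lam i)) zero_le_one fun i => (norm_cexp_I_mul τ _).le
  have hcont : ∀ x, Continuous fun τ => W τ x := by
    refine continuous_apply_of_basis b hWn fun i => ?_
    simp_rw [fun τ => b.diagonal_apply (hW τ) i]
    fun_prop
  have h0 : W 0 = 1 := ContinuousLinearMap.ext fun x => b.ext_inner fun i => by
    rw [hW]; simp
  refine ⟨W, fun τ => b.diagonal_mem_unitary (fun i => norm_cexp_I_mul τ _) (hW τ), h0,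
    fun σ τ => ContinuousLinearMap.ext fun x => b.ext_inner fun i => ?_, hcont, fun x y => ?_⟩
  · rw [clm_mul_apply, hW, hW, hW, ← mul_assoc, ← Complex.exp_add]
    push_cast
    ring_nf
  · rw [hA]
    have hd : ∀ (i : ι) (τ : ℝ), HasDerivAt (fun τ => inner ℂ (b i) (W τ x))
        (Complex.I * lam i * Complex.exp (Complex.I * τ * lam i) * inner ℂ (b i) x) τ :=
      fun i τ => by
        simp_rw [hW]
        exact (hasDerivAt_cexp_mul_I _ _).mul_const _
    constructor
    · intro h
      have := hasDerivWithinAt_of_weak (J := Set.univ) convex_univ (f := fun τ => W τ x)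
        (hcont (Complex.I • y)) (coordFunctional b) (coordFunctional_separating b)
        (fun i τ _ => ?_) (Set.mem_univ 0)
      · rw [h0] at this
        simpa using this
      · refine ((hd i τ).congr_deriv ?_).hasDerivWithinAt
        rw [coordFunctional_apply, hW, inner_smul_right, h i]
        ring
    · intro h i
      have h1 := (coordFunctional b i).hasFDerivAt.comp_hasDerivAt 0 h
      have h2 := h1.unique (hd i 0)
      rw [coordFunctional_apply, inner_smul_right] at h2
      simp only [Complex.ofReal_zero, mul_zero, zero_mul, Complex.exp_zero, mul_one,
        mul_assoc] at h2
      exact mul_left_cancel₀ Complex.I_ne_zero h2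

/-- The group generated by `iA` acts on an eigenvector of `A` by `e^{iτλ}`. -/
theorem IsUnitaryGroupOf.apply_eigenvector {W : ℝ → H →L[ℂ] H} (hW : IsUnitaryGroupOf A W)
    {x : H} {a : ℝ} (hx : (x, (a : ℂ) • x) ∈ A.graph) (τ : ℝ) :
    W τ x = Complex.exp (Complex.I * τ * a) • x := by
  have h0 := (hW.generator _ _).1 hx
  have h1 : ∀ τ, HasDerivAt (fun τ => W τ x) ((Complex.I * a) • W τ x) τ := fun τ => by
    have h2 : HasDerivAt (fun σ => W (σ - τ) x) (Complex.I • (a : ℂ) • x) τ := by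
      have := HasDerivAt.comp_sub_const (f := fun τ => W τ x) τ τ (by rwa [sub_self])
      exact this
    have h3 := ((W τ).restrictScalars ℝ).hasFDerivAt.comp_hasDerivAt τ h2
    refine (h3.congr_deriv ?_).congr_of_eventuallyEq (Filter.Eventually.of_forall fun σ => ?_)
    · change W τ (Complex.I • (a : ℂ) • x) = _
      rw [map_smul, map_smul, smul_smul]
    · change W σ x = W τ (W (σ - τ) x)
      rw [← clm_mul_apply, ← hW.add]; simp
  have h4 : ∀ τ : ℝ, HasDerivAt (fun τ : ℝ => Complex.exp (Complex.I * τ * ((-a : ℝ) : ℂ)) • W τ x)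
      0 τ := fun τ => by
    refine ((hasDerivAt_cexp_mul_I (-a) τ).smul (h1 τ)).congr_deriv ?_
    rw [smul_smul, ← add_smul]
    push_cast
    convert zero_smul ℂ (W τ x) using 2
    ring
  have h5 := is_const_of_deriv_eq_zero (fun t => (h4 t).differentiableAt)
      (fun t => (h4 t).deriv) τ 0
  simp only [hW.zero, Complex.ofReal_zero, mul_zero, zero_mul, Complex.exp_zero, one_smul,
    clm_one_apply] at h5
  conv_rhs => rw [← h5]
  rw [smul_smul, ← Complex.exp_add]
  push_cast
  ring_nf
  simp

theorem mem_graph_eigenbasis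
    (hA : ∀ x y, (x, y) ∈ A.graph ↔ ∀ i, inner ℂ (b i) y = lam i * inner ℂ (b i) x) (i : ι) :
    (b i, (lam i : ℂ) • b i) ∈ A.graph := by
  classical
  rw [hA]
  intro j
  rw [inner_smul_right, b.inner_self_ite]
  split_ifs with h
  · rw [h]
  · simp

theorem existsUnique_unitaryGroup_of_eigenbasis
    (hA : ∀ x y, (x, y) ∈ A.graph ↔ ∀ i, inner ℂ (b i) y = lam i * inner ℂ (b i) x) :
    ∃! W, IsUnitaryGroupOf A W := by
  obtain ⟨W, hW⟩ := exists_unitaryGroup_of_eigenbasis b hA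
  refine ⟨W, hW, fun W' hW' => funext fun τ => b.ext_clm fun i => ?_⟩
  rw [hW.apply_eigenvector (mem_graph_eigenbasis b hA i),
    hW'.apply_eigenvector (mem_graph_eigenbasis b hA i)]

end Group

end HilbertSpace

section Toeplitz

open ContinuousLinearMap
open scoped InnerProduct

variable {H : Type*} [NormedAddCommGroup H] [InnerProductSpace ℂ H] [CompleteSpace H]

/-! ### The number operator and the shift in a Hilbert space with a basis -/

/-- `g = D f`, where `D` is the self-adjoint operator with `D eₙ = n eₙ`. -/
def IsNumber (e : HilbertBasis ℕ ℂ H) (f g : H) : Prop :=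
  ∀ n : ℕ, inner ℂ (e n) g = n * inner ℂ (e n) f

variable {e : HilbertBasis ℕ ℂ H} {S K N : H →L[ℂ] H} {f f' g g' : H}

theorem IsNumber.unique (h : IsNumber e f g) (h' : IsNumber e f g') : g = g' :=
  e.ext_inner fun n => (h n).trans (h' n).symm

theorem IsNumber.smul (c : ℂ) (hf : IsNumber e f f') : IsNumber e (c • f) (c • f') := fun n => by
  rw [inner_smul_right, inner_smul_right, hf]; ring

theorem isNumber_basis (e : HilbertBasis ℕ ℂ H) (n : ℕ) : IsNumber e (e n) ((n : ℂ) • e n) :=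
  fun m => by
    rw [inner_smul_right, e.inner_self_ite]
    split_ifs with h
    · rw [h]
    · simp

/-- `D` is symmetric. -/
theorem IsNumber.inner_comm (hf : IsNumber e f f') (hg : IsNumber e g g') :
    inner ℂ f' g = inner ℂ f g' := by
  rw [← e.tsum_inner_mul_inner f' g, ← e.tsum_inner_mul_inner f g']
  refine tsum_congr fun n => ?_
  rw [← inner_conj_symm f', ← inner_conj_symm f, hf, hg, map_mul, Complex.conj_natCast]
  ring

section Shift

variable (hS : ∀ n, S (e n) = e (n + 1))
include hS

theorem inner_shift_adjoint (f : H) (n : ℕ) : inner ℂ (e n) ((S†) f) = inner ℂ (e (n + 1)) f := by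
  rw [adjoint_inner_right, hS]

theorem shift_adjoint_shift (f : H) : (S†) (S f) = f := by
  have : (S†) * S = 1 := e.ext_clm fun n => e.ext_inner fun m => by
    rw [clm_mul_apply, clm_one_apply, inner_shift_adjoint hS, hS, e.inner_self_ite,
      e.inner_self_ite]
    simp
  exact DFunLike.congr_fun this f

theorem inner_shift_shift (f g : H) : inner ℂ (S f) (S g) = inner ℂ f g := by
  rw [← adjoint_inner_right, shift_adjoint_shift hS]

theorem shift_adjoint_zero : (S†) (e 0) = 0 := e.ext_inner fun n => by
  rw [inner_shift_adjoint hS, e.inner_self_ite, inner_zero_right, if_neg (Nat.succ_ne_zero n)]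

theorem inner_zero_shift (f : H) : inner ℂ (e 0) (S f) = 0 := by
  rw [← adjoint_inner_left, shift_adjoint_zero hS, inner_zero_left]

theorem inner_succ_shift (f : H) (n : ℕ) : inner ℂ (e (n + 1)) (S f) = inner ℂ (e n) f := by
  rw [← hS, inner_shift_shift hS]

theorem shift_pow_basis (l n : ℕ) : (S ^ l) (e n) = e (n + l) := by
  induction l with
  | zero => simp
  | succ l ih => rw [pow_succ', clm_mul_apply, ih, hS, add_assoc]

theorem inner_shift_pow (f : H) (l n : ℕ) :
    inner ℂ (e n) ((S ^ l) f) = if l ≤ n then inner ℂ (e (n - l)) f else 0 := by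
  induction l generalizing n with
  | zero => simp
  | succ l ih =>
    rw [pow_succ', clm_mul_apply]
    cases n with
    | zero => rw [inner_zero_shift hS, if_neg (by omega)]
    | succ n =>
      rw [inner_succ_shift hS, ih]
      simp

theorem inner_shift_pow_shift_pow (f g : H) (l : ℕ) :
    inner ℂ ((S ^ l) f) ((S ^ l) g) = inner ℂ f g := by
  induction l with
  | zero => simp
  | succ l ih => rw [pow_succ', clm_mul_apply, clm_mul_apply, inner_shift_shift hS, ih]

/-- Removal of the mean and of one power of the shift: `f = ⟨e₀, f⟩ e₀ + S S* f`. -/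
theorem eq_mean_add_shift (f : H) : f = inner ℂ (e 0) f • e 0 + S ((S†) f) :=
    e.ext_inner fun n => by
  rw [inner_add_right, inner_smul_right, e.inner_self_ite]
  cases n with
  | zero => simp [inner_zero_shift hS]
  | succ n => simp [inner_succ_shift hS, inner_shift_adjoint hS]

theorem IsNumber.shift (hf : IsNumber e f f') : IsNumber e (S f) (S f' + S f) := fun n => by
  rw [inner_add_right]
  cases n with
  | zero => simp [inner_zero_shift hS]
  | succ n =>
    rw [inner_succ_shift hS, inner_succ_shift hS, hf]
    push_cast; ring

theorem IsNumber.shift_adjoint (hf : IsNumber e f f') : IsNumber e ((S†) f) ((S†) f' - (S†) f) :=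
  fun n => by
    rw [inner_sub_right, inner_shift_adjoint hS, inner_shift_adjoint hS, hf]
    push_cast; ring

theorem shift_adjoint_comm (hK : K * S = S * K) (f : H) :
    (S†) (K f) = K ((S†) f) + inner ℂ (e 0) f • (S†) (K (e 0)) := by
  conv_lhs => rw [eq_mean_add_shift hS f]
  rw [map_add, map_smul, map_add, map_smul, ← clm_mul_apply K S, hK, clm_mul_apply,
    shift_adjoint_shift hS, add_comm]

end Shift

theorem adjoint_comm_shift_adjoint (hK : K * S = S * K) (f : H) :
    (K†) ((S†) f) = (S†) ((K†) f) := by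
  have := congrArg adjoint hK
  rw [mul_def, mul_def, adjoint_comp, adjoint_comp] at this
  exact (DFunLike.congr_fun this f).symm

/-! ### Analytic Toeplitz operators and the Lax operator -/

/-- `K` is an analytic Toeplitz operator, i.e. it commutes with the shift, and `N` is the analytic
Toeplitz operator whose symbol `N e₀` is the image under `D` of the symbol `K e₀` of `K`. -/
structure IsSymbol (e : HilbertBasis ℕ ℂ H) (S K N : H →L[ℂ] H) : Prop where
  shift : ∀ n, S (e n) = e (n + 1)
  comm : K * S = S * K
  comm' : N * S = S * N
  number : IsNumber e (K (e 0)) (N (e 0))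

/-- `g = L f`, where `L = D - K K*`. -/
def IsLax (e : HilbertBasis ℕ ℂ H) (K : H →L[ℂ] H) (f g : H) : Prop :=
  IsNumber e f (g + K ((K†) f))

/-- The bounded skew-adjoint operator `B = -i (K N* + N K*) + i (K K*)²` of the Lax pair. -/
def laxB (K N : H →L[ℂ] H) : H →L[ℂ] H :=
  (-Complex.I) • (K * (N†) + N * (K†)) + Complex.I • (K * (K†) * (K * (K†)))

theorem star_laxB (K N : H →L[ℂ] H) : star (laxB K N) = -laxB K N := by
  simp only [laxB, ← star_eq_adjoint, star_add, star_smul, star_mul, star_star, star_neg,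
    Complex.star_def, Complex.conj_I, neg_neg, mul_assoc]
  module

theorem laxB_apply (K N : H →L[ℂ] H) (f : H) :
    laxB K N f = (-Complex.I) • (K ((N†) f) + N ((K†) f)) + Complex.I • K ((K†) (K ((K†) f))) := rfl

theorem inner_laxB_left (K N : H →L[ℂ] H) (f g : H) :
    inner ℂ (laxB K N f) g = -inner ℂ f (laxB K N g) := by
  rw [← adjoint_inner_right, ← star_eq_adjoint, star_laxB, ← inner_neg_right]
  rfl

theorem inner_laxB (K N : H →L[ℂ] H) (f g : H) :
    inner ℂ g (laxB K N f) = -Complex.I * (inner ℂ ((K†) g) ((N†) f) + inner ℂ ((N†) g) ((K†) f))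
      + Complex.I * inner ℂ (K ((K†) g)) (K ((K†) f)) := by
  rw [laxB_apply, inner_add_right, inner_smul_right, inner_smul_right, inner_add_right,
    adjoint_inner_left, adjoint_inner_left, ← adjoint_inner_right K ((K†) g), adjoint_inner_left]

theorem IsLax.inner_comm (hf : IsLax e K f f') (hg : IsLax e K g g') :
    inner ℂ f' g = inner ℂ f g' := by
  have := IsNumber.inner_comm hf hg
  rwa [inner_add_left, inner_add_right, ← adjoint_inner_right, ← adjoint_inner_left K,
    add_left_inj] at this

theorem IsNumber.isLax (hf : IsNumber e f f') : IsLax e K f (f' - K ((K†) f)) := by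
  rwa [IsLax, sub_add_cancel]

theorem IsLax.unique (h : IsLax e K f g) (h' : IsLax e K f g') : g = g' :=
  add_right_cancel (IsNumber.unique h h')

namespace IsSymbol

variable (h : IsSymbol e S K N)
include h

theorem number_basis (n : ℕ) : IsNumber e (K (e n)) ((n : ℂ) • K (e n) + N (e n)) := by
  induction n with
  | zero => simpa using h.number
  | succ n ih =>
    have := ih.shift h.shift
    have hK : S (K (e n)) = K (e (n + 1)) := by
      rw [← h.shift, ← clm_mul_apply, ← h.comm, clm_mul_apply]
    have hN : S (N (e n)) = N (e (n + 1)) := by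
      rw [← h.shift, ← clm_mul_apply, ← h.comm', clm_mul_apply]
    rw [map_add, map_smul, hK, hN] at this
    convert this using 1
    push_cast
    module

/-- `D K* = K* D - N*` on the domain of `D`. -/
theorem number_adjoint (hf : IsNumber e f f') :
    IsNumber e ((K†) f) ((K†) f' - (N†) f) := fun n => by
  rw [inner_sub_right, adjoint_inner_right, adjoint_inner_right, adjoint_inner_right,
    ← (h.number_basis n).inner_comm hf, inner_add_left, inner_smul_left, Complex.conj_natCast]
  ring

/-- `D K = K D + N` on the domain of `D`. -/
theorem number_apply (hf : IsNumber e f f') : IsNumber e (K f) (K f' + N f) := fun n => by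
  rw [inner_add_right, ← adjoint_inner_left, ← adjoint_inner_left, ← adjoint_inner_left,
    ← (h.number_adjoint (isNumber_basis e n)).inner_comm hf, inner_sub_left, map_smul,
    inner_smul_left, Complex.conj_natCast]
  ring

/-- The two expressions of the form of the operator
`A = -i D² + 2 i K D K* = B - i L²`, for which the equation is `∂ₜu = A u`. -/
theorem form_eq (hf : IsNumber e f f') (hg : IsNumber e g g') :
    inner ℂ g (laxB K N f) - Complex.I * inner ℂ (g' - K ((K†) g)) (f' - K ((K†) f))
      = Complex.I * (-inner ℂ g' f' + 2 * inner ℂ ((K†) g) ((K†) f' - (N†) f)) := by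
  have h1 := (h.number_adjoint hg).inner_comm (h.number_adjoint hf)
  rw [inner_laxB]
  simp only [inner_sub_left, inner_sub_right] at h1 ⊢
  rw [← adjoint_inner_left K ((K†) f) g', ← adjoint_inner_right K ((K†) g) f']
  linear_combination Complex.I * h1

/-- The commutator of the backward shift with the Lax operator. -/
theorem lax_shift_adjoint (hf : IsLax e K f f') :
    IsLax e K ((S†) f) ((S†) f' - (S†) f + inner ℂ (K (e 0)) f • (S†) (K (e 0))) := by
  have h1 : IsNumber e ((S†) f) _ := IsNumber.shift_adjoint h.shift hf
  rw [map_add, shift_adjoint_comm h.shift h.comm, adjoint_inner_right,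
    ← adjoint_comm_shift_adjoint h.comm] at h1
  rw [IsLax]
  convert h1 using 1
  abel

/-- The commutator of the backward shift with the operator `B`. -/
theorem laxB_shift_adjoint (f : H) :
    (S†) (laxB K N f) - laxB K N ((S†) f) = (-Complex.I) •
      (inner ℂ (N (e 0) - K ((K†) (K (e 0)))) f • (S†) (K (e 0))
        + inner ℂ (K (e 0)) f • ((S†) (N (e 0)) - K ((K†) ((S†) (K (e 0)))))) := by
  have cK := shift_adjoint_comm h.shift h.comm
  have cN := shift_adjoint_comm h.shift h.comm'
  have aK := adjoint_comm_shift_adjoint h.comm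
  have aN := adjoint_comm_shift_adjoint h.comm'
  have e1 : inner ℂ (K ((K†) (K (e 0)))) f = inner ℂ (e 0) ((K†) (K ((K†) f))) := by
    rw [adjoint_inner_right, ← adjoint_inner_right, adjoint_inner_left]
  rw [laxB_apply, laxB_apply, inner_sub_left, e1, ← adjoint_inner_right K, ← adjoint_inner_right N]
  simp only [map_add, map_smul]
  rw [cK ((N†) f), cN ((K†) f), cK ((K†) (K ((K†) f))), ← aK (K ((K†) f)), cK ((K†) f), aK f, aN f,
    map_add, map_add, map_smul, map_smul]
  module

end IsSymbol

end Toeplitz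

section Toeplitz

open ContinuousLinearMap
open scoped InnerProduct

variable {H : Type*} [NormedAddCommGroup H] [InnerProductSpace ℂ H] [CompleteSpace H]
variable {e : HilbertBasis ℕ ℂ H} {S K N : H →L[ℂ] H} {f f' g g' : H}

/-! ### Toeplitz matrices and the Lax equation -/

theorem sum_basis_of_inner_eq_zero {L : ℕ} {p : H} (hp : ∀ l, L ≤ l → inner ℂ (e l) p = 0) :
    p = ∑ l ∈ Finset.range L, inner ℂ (e l) p • e l := e.ext_inner fun n => by
  rw [inner_sum]
  simp only [inner_smul_right, e.inner_self_ite, mul_ite, mul_one, mul_zero]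
  rw [Finset.sum_ite_eq]
  split_ifs with h
  · rfl
  · exact hp n (by simpa using h)

theorem inner_eq_sum_of_inner_eq_zero {L : ℕ} {p : H} (hp : ∀ l, L ≤ l → inner ℂ (e l) p = 0)
    (q : H) : inner ℂ p q = ∑ l ∈ Finset.range L, inner ℂ p (e l) * inner ℂ (e l) q := by
  conv_lhs => rw [sum_basis_of_inner_eq_zero hp]
  rw [sum_inner]
  refine Finset.sum_congr rfl fun l _ => ?_
  rw [inner_smul_left, inner_conj_symm]

theorem inner_eq_sum_of_inner_eq_zero' {L : ℕ} {q : H} (hq : ∀ l, L ≤ l → inner ℂ (e l) q = 0)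
    (p : H) : inner ℂ p q = ∑ l ∈ Finset.range L, inner ℂ p (e l) * inner ℂ (e l) q := by
  conv_lhs => rw [sum_basis_of_inner_eq_zero hq]
  rw [inner_sum]
  refine Finset.sum_congr rfl fun l _ => ?_
  rw [inner_smul_right, mul_comm]

namespace IsSymbol

variable (h : IsSymbol e S K N)
include h

/-- Between eigenvectors of `L`, the commutator of the backward shift `S*` with `B` has the same
matrix as `-i ((L + 1)² S* - S* L²)`: the finite rank corrections cancel. -/
theorem inner_laxB_shift_adjoint {a c : ℝ} (hf : IsLax e K f ((a : ℂ) • f))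
    (hg : IsLax e K g ((c : ℂ) • g)) :
    inner ℂ g ((S†) (laxB K N f)) + inner ℂ (laxB K N g) ((S†) f)
      = -Complex.I * (((c : ℂ) + 1) ^ 2 - (a : ℂ) ^ 2) * inner ℂ g ((S†) f) := by
  set u := K (e 0)
  have hu : IsLax e K u (N (e 0) - K ((K†) u)) := h.number.isLax
  have hSu := hu.inner_comm hf
  have h1 := hg.inner_comm (h.lax_shift_adjoint hf)
  have hw : IsLax e K ((S†) u) ((S†) (N (e 0)) - (S†) u - K ((K†) ((S†) u))) :=
    (h.number.shift_adjoint h.shift).isLax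
  have h2 := hg.inner_comm hw
  have h3 := congrArg (inner ℂ g) (h.laxB_shift_adjoint f)
  rw [inner_laxB_left]
  simp only [inner_smul_left, inner_smul_right, inner_add_right, inner_sub_right,
    inner_sub_left, map_smul, Complex.conj_ofReal] at *
  linear_combination h3 + (-Complex.I) * inner ℂ g ((S†) u) * hSu
    + Complex.I * inner ℂ u f * h2 + Complex.I * ((a : ℂ) + c + 1) * h1

theorem inner_apply_basis (m l : ℕ) :
    inner ℂ (e m) (K (e l)) = if l ≤ m then inner ℂ (e (m - l)) (K (e 0)) else 0 := by
  have hc : Commute K (S ^ l) := Commute.pow_right h.comm l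
  rw [← inner_shift_pow h.shift, ← clm_mul_apply, ← hc.eq, clm_mul_apply, shift_pow_basis h.shift,
    zero_add]

theorem inner_apply_shift_pow (m l : ℕ) (w : H) :
    inner ℂ (e m) (K ((S ^ l) w)) = if l ≤ m then inner ℂ (e (m - l)) (K w) else 0 := by
  have hc : Commute K (S ^ l) := Commute.pow_right h.comm l
  rw [← inner_shift_pow h.shift, ← clm_mul_apply, hc.eq, clm_mul_apply]

theorem inner_adjoint_basis_of_lt {m l : ℕ} (hl : m < l) : inner ℂ (e l) ((K†) (e m)) = 0 := by
  rw [← inner_conj_symm, adjoint_inner_left, h.inner_apply_basis, if_neg (by omega), map_zero]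

/-- The Toeplitz matrix of `w = D K* K e₀`, in terms of that of `K* K`. -/
theorem inner_shift_pow_number {w : H} (hw : IsNumber e ((K†) (K (e 0))) w) (k l : ℕ) :
    inner ℂ (e k) ((S ^ l) w)
      = if l ≤ k then ((k : ℂ) - l) * inner ℂ (K (e k)) (K (e l)) else 0 := by
  rw [inner_shift_pow h.shift]
  refine if_ctx_congr Iff.rfl (fun hlk => ?_) fun _ => rfl
  obtain ⟨j, rfl⟩ := Nat.exists_eq_add_of_le hlk
  have hc : ∀ i, K (e (i + l)) = (S ^ l) (K (e i)) := fun i => by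
    have hc : Commute K (S ^ l) := Commute.pow_right h.comm l
    rw [← shift_pow_basis h.shift, ← clm_mul_apply, hc.eq, clm_mul_apply]
  have hc0 := hc 0
  rw [zero_add] at hc0
  rw [Nat.add_sub_cancel_left, hw, adjoint_inner_right, add_comm l j, hc, hc0,
    inner_shift_pow_shift_pow h.shift]
  push_cast
  ring

theorem inner_shift_pow_number_sub {w : H} (hw : IsNumber e ((K†) (K (e 0))) w) (k l : ℕ) :
    inner ℂ (e k) ((S ^ l) w) - inner ℂ ((S ^ k) w) (e l)
      = ((k : ℂ) - l) * inner ℂ (K (e k)) (K (e l)) := by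
  rw [← inner_conj_symm _ (e l), h.inner_shift_pow_number hw, h.inner_shift_pow_number hw]
  rcases lt_trichotomy k l with hkl | rfl | hkl
  · rw [if_neg (by omega), if_pos hkl.le, map_mul, inner_conj_symm, map_sub,
      Complex.conj_natCast, Complex.conj_natCast]
    ring
  · simp
  · rw [if_pos hkl.le, if_neg (by omega), map_zero, sub_zero]

/-- The commutator of `D` with the Toeplitz operator `K* K` has the symbol `w - w̄`, tested against
finite combinations of basis vectors. -/
theorem sum_inner_shift_pow_number {w : H} (hw : IsNumber e ((K†) (K (e 0))) w) {L : ℕ}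
    {p p' q q' : H} (hp : ∀ l, L ≤ l → inner ℂ (e l) p = 0)
    (hq : ∀ l, L ≤ l → inner ℂ (e l) q = 0) (hp' : IsNumber e p p') (hq' : IsNumber e q q') :
    ∑ l ∈ Finset.range L, (inner ℂ p ((S ^ l) w) * inner ℂ (e l) q
        - inner ℂ p (e l) * inner ℂ ((S ^ l) w) q)
      = inner ℂ (K p') (K q) - inner ℂ (K p) (K q') := by
  have hd : ∀ {x x' : H}, (∀ l, L ≤ l → inner ℂ (e l) x = 0) → IsNumber e x x' →
      ∀ l, L ≤ l → inner ℂ (e l) x' = 0 := fun hx hx' l hl => by rw [hx', hx l hl, mul_zero]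
  have hKK : ∀ x y : H, (∀ l, L ≤ l → inner ℂ (e l) x = 0) → (∀ l, L ≤ l → inner ℂ (e l) y = 0) →
      inner ℂ (K x) (K y) = ∑ k ∈ Finset.range L, ∑ l ∈ Finset.range L,
        inner ℂ x (e k) * inner ℂ (e l) y * inner ℂ (K (e k)) (K (e l)) := by
    intro x y hx hy
    rw [← adjoint_inner_right, inner_eq_sum_of_inner_eq_zero hx]
    refine Finset.sum_congr rfl fun k _ => ?_
    rw [adjoint_inner_right, ← adjoint_inner_left, inner_eq_sum_of_inner_eq_zero' hy,
      Finset.mul_sum]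
    refine Finset.sum_congr rfl fun l _ => ?_
    rw [adjoint_inner_left]; ring
  have hconj : ∀ {x x' : H}, IsNumber e x x' → ∀ k, inner ℂ x' (e k) = k * inner ℂ x (e k) :=
    fun hx k => by
      rw [← inner_conj_symm, hx, map_mul, inner_conj_symm, Complex.conj_natCast]
  rw [hKK _ _ (hd hp hp') hq, hKK _ _ hp (hd hq hq'), ← Finset.sum_sub_distrib,
    Finset.sum_sub_distrib]
  have e1 : ∑ l ∈ Finset.range L, inner ℂ p ((S ^ l) w) * inner ℂ (e l) q
      = ∑ k ∈ Finset.range L, ∑ l ∈ Finset.range L,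
        inner ℂ p (e k) * inner ℂ (e l) q * inner ℂ (e k) ((S ^ l) w) := by
    rw [Finset.sum_comm]
    refine Finset.sum_congr rfl fun l _ => ?_
    rw [inner_eq_sum_of_inner_eq_zero hp, Finset.sum_mul]
    exact Finset.sum_congr rfl fun k _ => by ring
  have e2 : ∑ l ∈ Finset.range L, inner ℂ p (e l) * inner ℂ ((S ^ l) w) q
      = ∑ k ∈ Finset.range L, ∑ l ∈ Finset.range L,
        inner ℂ p (e k) * inner ℂ (e l) q * inner ℂ ((S ^ k) w) (e l) := by
    refine Finset.sum_congr rfl fun k _ => ?_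
    rw [inner_eq_sum_of_inner_eq_zero' hq, Finset.mul_sum]
    exact Finset.sum_congr rfl fun l _ => by ring
  rw [e1, e2, ← Finset.sum_sub_distrib]
  refine Finset.sum_congr rfl fun k _ => ?_
  rw [← Finset.sum_sub_distrib, ← Finset.sum_sub_distrib]
  refine Finset.sum_congr rfl fun l _ => ?_
  rw [hconj hp', hq']
  linear_combination inner ℂ p (e k) * inner ℂ (e l) q * h.inner_shift_pow_number_sub hw k l

/-- The Lax equation `∂ₜL = [B, L]`, tested against basis vectors: the right-hand side is the time
derivative of `⟨K* e_m, K* e_n⟩` that the equation prescribes. -/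
theorem laxEquation_basis {w : H} (hw : IsNumber e ((K†) (K (e 0))) w) (m n : ℕ) {L : ℕ}
    (hm : m < L) (hn : n < L) :
    ∑ l ∈ Finset.range L,
      (Complex.I * (-((m : ℂ) - l) ^ 2 * inner ℂ (e m) (K (e l))
            + 2 * inner ℂ (e m) (K ((S ^ l) w))) * inner ℂ (K (e l)) (e n)
        + inner ℂ (e m) (K (e l)) * (-Complex.I * (-((n : ℂ) - l) ^ 2 * inner ℂ (K (e l)) (e n)
            + 2 * inner ℂ (K ((S ^ l) w)) (e n))))
      = inner ℂ ((m : ℂ) • e m - K ((K†) (e m))) (laxB K N (e n))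
        + inner ℂ (laxB K N (e m)) ((n : ℂ) • e n - K ((K†) (e n))) := by
  set p := (K†) (e m) with hpdef
  set q := (K†) (e n) with hqdef
  have hp : ∀ l, L ≤ l → inner ℂ (e l) p = 0 := fun l hl =>
    h.inner_adjoint_basis_of_lt (by omega)
  have hq : ∀ l, L ≤ l → inner ℂ (e l) q = 0 := fun l hl =>
    h.inner_adjoint_basis_of_lt (by omega)
  have hp' := h.number_adjoint (isNumber_basis e m)
  have hq' := h.number_adjoint (isNumber_basis e n)
  have s0 := inner_eq_sum_of_inner_eq_zero hp q
  have s1 := inner_eq_sum_of_inner_eq_zero hp ((K†) ((n : ℂ) • e n) - (N†) (e n))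
  have s2 := h.sum_inner_shift_pow_number hw hp hq hp' hq'
  have d1 := hp'.inner_comm hq'
  have d2 := (h.number_apply hp').inner_comm (h.number_apply hq')
  simp only [← adjoint_inner_left K, ← adjoint_inner_right K]
  have hsum : ∑ l ∈ Finset.range L,
      (Complex.I * (-((m : ℂ) - l) ^ 2 * inner ℂ p (e l)
            + 2 * inner ℂ p ((S ^ l) w)) * inner ℂ (e l) q
        + inner ℂ p (e l) * (-Complex.I * (-((n : ℂ) - l) ^ 2 * inner ℂ (e l) q
            + 2 * inner ℂ ((S ^ l) w) q)))
      = Complex.I * ((n : ℂ) ^ 2 - m ^ 2) * inner ℂ p q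
        + 2 * Complex.I * ((m : ℂ) - n) * inner ℂ p ((K†) ((n : ℂ) • e n) - (N†) (e n))
        + 2 * Complex.I * (inner ℂ (K ((K†) ((m : ℂ) • e m) - (N†) (e m))) (K q)
          - inner ℂ (K p) (K ((K†) ((n : ℂ) • e n) - (N†) (e n)))) := by
    rw [s0, s1, ← s2, Finset.mul_sum, Finset.mul_sum, Finset.mul_sum, ← Finset.sum_add_distrib,
      ← Finset.sum_add_distrib]
    refine Finset.sum_congr rfl fun l _ => ?_
    rw [hq' l]
    ring
  have t1 : inner ℂ (K p) (laxB K N (e n)) = -Complex.I * (inner ℂ (K p) (K ((N†) (e n)))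
      + inner ℂ (K p) (N q)) + Complex.I * inner ℂ ((K†) (K p)) ((K†) (K q)) := by
    rw [inner_laxB, adjoint_inner_left K, adjoint_inner_left N,
      adjoint_inner_right K ((K†) (K p)) (K q)]
  have t2 : inner ℂ (e m) (laxB K N (K q)) = -Complex.I * (inner ℂ (N p) (K q)
      + inner ℂ (K ((N†) (e m))) (K q)) + Complex.I * inner ℂ ((K†) (K p)) ((K†) (K q)) := by
    rw [inner_laxB, adjoint_inner_right N, adjoint_inner_right K ((N†) (e m)),
      adjoint_inner_left K _ (K p)]
  have t3 : ∀ x : H, inner ℂ (e m) (laxB K N (x - K q))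
      = inner ℂ (e m) (laxB K N x) - inner ℂ (e m) (laxB K N (K q)) := fun x => by
    rw [map_sub, inner_sub_right]
  have t4 : inner ℂ (e m) (laxB K N ((n : ℂ) • e n)) = n * inner ℂ (e m) (laxB K N (e n)) := by
    rw [map_smul, inner_smul_right]
  rw [hsum, inner_laxB_left, t3, t2, inner_sub_left _ (K p), t1, t4, inner_smul_left,
    inner_laxB K N (e n) (e m)]
  simp only [map_sub, map_smul, inner_sub_left, inner_sub_right, inner_add_left, inner_add_right,
    inner_smul_left, inner_smul_right, Complex.conj_natCast, ← hpdef, ← hqdef] at d1 d2 ⊢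
  linear_combination (-Complex.I * ((m : ℂ) - n)) * d1 + Complex.I * d2

end IsSymbol

end Toeplitz

section Resolvent

open ContinuousLinearMap
open scoped InnerProduct

/-! ### The resolvent of the Lax operator -/

/-- `T` is the resolvent `(D + ρ)⁻¹`. -/
def IsNumberResolvent {H : Type*} [NormedAddCommGroup H] [InnerProductSpace ℂ H]
    (e : HilbertBasis ℕ ℂ H) (ρ : ℝ) (T : H →L[ℂ] H) : Prop :=
  ∀ x n, inner ℂ (e n) (T x) = ((n : ℂ) + ρ)⁻¹ * inner ℂ (e n) x

variable {H : Type*} [NormedAddCommGroup H] [InnerProductSpace ℂ H] [CompleteSpace H]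
variable {e : HilbertBasis ℕ ℂ H} {K T : H →L[ℂ] H} {f f' g x y : H} {ρ : ℝ}

theorem natCast_add_ofReal_ne_zero (hρ : 0 < ρ) (n : ℕ) : (n : ℂ) + ρ ≠ 0 := by
  have : (0 : ℝ) < n + ρ := by positivity
  exact_mod_cast this.ne'

theorem exists_isNumberResolvent (e : HilbertBasis ℕ ℂ H) (hρ : 0 < ρ) :
    ∃ T, IsNumberResolvent e ρ T ∧ ‖T‖ ≤ ρ⁻¹ := by
  refine e.exists_diagonal _ (by positivity) fun n => ?_
  have : (0 : ℝ) < n + ρ := by positivity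
  rw [norm_inv, show (n : ℂ) + ρ = ((n + ρ : ℝ) : ℂ) by push_cast; rfl,
    Complex.norm_of_nonneg this.le]
  gcongr
  simp

namespace IsNumberResolvent

theorem isNumber (hT : IsNumberResolvent e ρ T) (hρ : 0 < ρ) (x : H) :
    IsNumber e (T x) (x - (ρ : ℂ) • T x) := fun n => by
  have := natCast_add_ofReal_ne_zero hρ n
  rw [inner_sub_right, inner_smul_right, hT]
  field_simp
  ring

theorem apply_number (hT : IsNumberResolvent e ρ T) (hρ : 0 < ρ) (hf : IsNumber e f f') :
    T (f' + (ρ : ℂ) • f) = f := e.ext_inner fun n => by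
  have := natCast_add_ofReal_ne_zero hρ n
  rw [hT, inner_add_right, inner_smul_right, hf]
  field_simp

theorem adjoint_eq (hT : IsNumberResolvent e ρ T) : T† = T := by
  refine e.ext_clm fun n => e.ext_inner fun m => ?_
  rw [adjoint_inner_right, e.diagonal_apply hT, e.diagonal_apply hT, inner_smul_left,
    inner_smul_right, e.inner_self_ite]
  split_ifs with h
  · subst h; simp
  · simp

theorem isCompactOperator (hT : IsNumberResolvent e ρ T) : IsCompactOperator T := by
  refine e.isCompactOperator_diagonal ?_ hT
  have h : Filter.Tendsto (fun n : ℕ => ((n : ℝ) + ρ)⁻¹) Filter.atTop (𝓝 0) :=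
    tendsto_inv_atTop_zero.comp
      (Filter.tendsto_atTop_add_const_right _ ρ tendsto_natCast_atTop_atTop)
  simpa [Function.comp_def] using (Complex.continuous_ofReal.tendsto 0).comp h

end IsNumberResolvent

/-- The operator `1 - K K* (D + ρ)⁻¹ = (L + ρ) (D + ρ)⁻¹`. -/
def resolventFactor (K T : H →L[ℂ] H) : H →L[ℂ] H := 1 - K * K† * T

theorem resolventFactor_apply (K T : H →L[ℂ] H) (x : H) :
    resolventFactor K T x = x - K ((K†) (T x)) := rfl

theorem isUnit_resolventFactor {C : ℝ} (hK : ‖K‖ ≤ C) (hρ : C * C < ρ) (hT : ‖T‖ ≤ ρ⁻¹) :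
    IsUnit (resolventFactor K T) := by
  have hC : 0 ≤ C := (norm_nonneg _).trans hK
  have hρ0 : 0 < ρ := lt_of_le_of_lt (by positivity) hρ
  have hKa : ‖K†‖ ≤ C := by rwa [LinearIsometryEquiv.norm_map]
  refine (Units.oneSub (K * K† * T) ?_).isUnit
  calc ‖K * K† * T‖ ≤ ‖K‖ * ‖K†‖ * ‖T‖ :=
        (norm_mul_le _ _).trans (by gcongr; exact norm_mul_le _ _)
    _ ≤ C * C * ρ⁻¹ := by gcongr
    _ < 1 := by rw [← div_eq_mul_inv, div_lt_one hρ0]; exact hρ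

/-- The resolvent `(L + ρ)⁻¹ = (D + ρ)⁻¹ (1 - K K* (D + ρ)⁻¹)⁻¹`. -/
def laxResolvent (K T : H →L[ℂ] H) : H →L[ℂ] H := T * Ring.inverse (resolventFactor K T)

theorem isLax_apply_numberResolvent (hT : IsNumberResolvent e ρ T) (hρ : 0 < ρ) (x : H) :
    IsLax e K (T x) (resolventFactor K T x - (ρ : ℂ) • T x) := by
  have := (hT.isNumber hρ x).isLax (K := K)
  convert this using 1
  rw [resolventFactor_apply]
  abel

theorem isLax_laxResolvent (hT : IsNumberResolvent e ρ T) (hρ : 0 < ρ)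
    (hZ : IsUnit (resolventFactor K T)) (x : H) :
    IsLax e K (laxResolvent K T x) (x - (ρ : ℂ) • laxResolvent K T x) := by
  have := isLax_apply_numberResolvent (K := K) hT hρ (Ring.inverse (resolventFactor K T) x)
  rwa [← clm_mul_apply (resolventFactor K T), Ring.mul_inverse_cancel _ hZ, clm_one_apply] at this

theorem laxResolvent_apply (hT : IsNumberResolvent e ρ T) (hρ : 0 < ρ)
    (hZ : IsUnit (resolventFactor K T)) (hf : IsLax e K f g) :
    laxResolvent K T (g + (ρ : ℂ) • f) = f := by
  have h1 := hT.apply_number hρ hf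
  have h2 : resolventFactor K T (g + K ((K†) f) + (ρ : ℂ) • f) = g + (ρ : ℂ) • f := by
    rw [resolventFactor_apply, h1]; abel
  rw [← h2, laxResolvent, clm_mul_apply, ← clm_mul_apply _ (resolventFactor K T),
    Ring.inverse_mul_cancel _ hZ, clm_one_apply, h1]

theorem adjoint_laxResolvent (hT : IsNumberResolvent e ρ T) (hρ : 0 < ρ)
    (hZ : IsUnit (resolventFactor K T)) : (laxResolvent K T)† = laxResolvent K T := by
  refine ContinuousLinearMap.ext fun x => ext_inner_right ℂ fun y => ?_
  have := (isLax_laxResolvent hT hρ hZ x).inner_comm (isLax_laxResolvent hT hρ hZ y)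
  rw [inner_sub_left, inner_sub_right, inner_smul_left, inner_smul_right,
    Complex.conj_ofReal, sub_left_inj] at this
  rw [adjoint_inner_left, this]

/-- The Lax operator is self-adjoint with compact resolvent: it is diagonal, with maximal domain,
in a Hilbert basis of eigenvectors. -/
theorem exists_eigenbasis_isLax.{v} {H : Type v} [NormedAddCommGroup H] [InnerProductSpace ℂ H]
    [CompleteSpace H] (e : HilbertBasis ℕ ℂ H) (K : H →L[ℂ] H) :
    ∃ (ι : Type v) (b : HilbertBasis ι ℂ H) (lam : ι → ℝ),
      ∀ f g, IsLax e K f g ↔ ∀ i, inner ℂ (b i) g = lam i * inner ℂ (b i) f := by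
  obtain ⟨ρ, hρ⟩ := exists_gt (‖K‖ * ‖K‖)
  have hρ0 : 0 < ρ := lt_of_le_of_lt (by positivity) hρ
  obtain ⟨T, hT, hTn⟩ := exists_isNumberResolvent e hρ0
  have hZ := isUnit_resolventFactor le_rfl hρ hTn
  set R := laxResolvent K T with hR
  have hsymm : ∀ x y, inner ℂ (R x) y = inner ℂ x (R y) := fun x y => by
    rw [← adjoint_inner_left, adjoint_laxResolvent hT hρ0 hZ]
  have hc : IsCompactOperator R :=
    IsCompactOperator.comp_clm hT.isCompactOperator (Ring.inverse (resolventFactor K T))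
  have hzero : IsLax e K 0 0 := fun n => by simp
  obtain ⟨ι, b, μ, hμ, hb⟩ := exists_hilbertBasis_eigenvectors hc hsymm fun x hx => by
    have := isLax_laxResolvent hT hρ0 hZ x
    rw [← hR, hx, smul_zero, sub_zero] at this
    exact this.unique hzero
  have hμ' : ∀ i, (μ i : ℂ) ≠ 0 := fun i => Complex.ofReal_ne_zero.2 (hμ i)
  have hbL : ∀ i, IsLax e K (b i) ((((μ i)⁻¹ - ρ : ℝ) : ℂ) • b i) := fun i => by
    have h1 := isLax_laxResolvent hT hρ0 hZ (b i)
    rw [← hR, hb] at h1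
    have h2 := IsNumber.smul (μ i : ℂ)⁻¹ h1
    rw [smul_smul, inv_mul_cancel₀ (hμ' i), one_smul] at h2
    rw [IsLax]
    convert h2 using 1
    rw [map_smul, map_smul, smul_add, smul_smul _ (μ i : ℂ) (K _), inv_mul_cancel₀ (hμ' i),
      one_smul, smul_sub, smul_smul, smul_smul]
    push_cast
    rw [sub_smul, mul_right_comm, inv_mul_cancel₀ (hμ' i), one_mul]
  refine ⟨ι, b, fun i => (μ i)⁻¹ - ρ, fun f g => ⟨fun h i => ?_, fun h => ?_⟩⟩
  · have := (hbL i).inner_comm h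
    rw [inner_smul_left, Complex.conj_ofReal] at this
    exact this.symm
  · have h1 : R (g + (ρ : ℂ) • f) = f := b.ext_inner fun i => by
      rw [← hsymm, hb, inner_smul_left, Complex.conj_ofReal, inner_add_right, inner_smul_right, h]
      push_cast
      have := hμ' i
      field_simp
      ring
    have h2 := isLax_laxResolvent hT hρ0 hZ (g + (ρ : ℂ) • f)
    rwa [← hR, h1, add_sub_cancel_right] at h2

end Resolvent

section Flow

open ContinuousLinearMap
open scoped InnerProduct

/-! ### Differential equations on an interval -/

/-- Leibniz rule at a zero of the differentiated factor: the other factor need only be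
continuous. -/
theorem hasDerivWithinAt_of_eq_zero {E F G : Type*} [NormedAddCommGroup E] [NormedSpace ℝ E]
    [NormedAddCommGroup F] [NormedAddCommGroup G] [NormedSpace ℝ G]
    {β : E → F → G} (hβ : Continuous fun p : E × F => β p.1 p.2)
    (hs : ∀ (a : ℝ) x y, β (a • x) y = a • β x y) {J : Set ℝ} {t : ℝ} {P : ℝ → E} {P' : E}
    {c : ℝ → F} (hP : HasDerivWithinAt P P' J t) (h0 : P t = 0) (hc : ContinuousWithinAt c J t) :
    HasDerivWithinAt (fun r => β (P r) (c r)) (β P' (c t)) J t := by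
  rw [hasDerivWithinAt_iff_tendsto_slope] at hP ⊢
  have h1 : Filter.Tendsto c (𝓝[J \ {t}] t) (𝓝 (c t)) := hc.mono Set.sdiff_subset
  refine ((hβ.tendsto (P', c t)).comp (hP.prodMk_nhds h1)).congr fun r => ?_
  have h2 : β (P t) (c t) = 0 := by
    have := hs 0 (P t) (c t)
    rwa [zero_smul, zero_smul, ← h0] at this
  change β (slope P t r) (c r) = _
  rw [slope_def_module, slope_def_module, h2, h0, sub_zero, sub_zero, hs]

/-- A solution of `y' = i α y` on an interval containing `0`. -/
theorem eq_cexp_mul_of_hasDerivWithinAt {J : Set ℝ} (hJ : Convex ℝ J) (h0 : (0 : ℝ) ∈ J)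
    {y : ℝ → ℂ} {a : ℝ} (hy : ∀ t ∈ J, HasDerivWithinAt y (Complex.I * a * y t) J t) {t : ℝ}
    (ht : t ∈ J) : y t = Complex.exp (Complex.I * t * a) * y 0 := by
  have h1 := eq_of_hasDerivWithinAt_zero hJ
    (f := fun t : ℝ => Complex.exp (Complex.I * t * ((-a : ℝ) : ℂ)) * y t)
    (fun t ht => (((hasDerivAt_cexp_mul_I (-a) t).hasDerivWithinAt).mul (hy t ht)).congr_deriv
      (by push_cast; ring)) h0 ht
  simp only [Complex.ofReal_zero, mul_zero, zero_mul, Complex.exp_zero, one_mul] at h1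
  rw [← h1, ← mul_assoc, ← Complex.exp_add]
  push_cast
  ring_nf
  simp

variable {H : Type*} [NormedAddCommGroup H] [InnerProductSpace ℂ H] [CompleteSpace H]

theorem hasDerivWithinAt_clm_apply {U : ℝ → H →L[ℂ] H} {U' : H →L[ℂ] H} {t : ℝ} {J : Set ℝ}
    (h : HasDerivWithinAt U U' J t) (x : H) : HasDerivWithinAt (fun t => U t x) (U' x) J t :=
  ((ContinuousLinearMap.apply ℂ H x).restrictScalars ℝ).hasFDerivAt.comp_hasDerivWithinAt t h

theorem hasDerivWithinAt_inner_const_left {y : ℝ → H} {y' : H} {t : ℝ} {J : Set ℝ}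
    (h : HasDerivWithinAt y y' J t) (x : H) :
    HasDerivWithinAt (fun t => inner ℂ x (y t)) (inner ℂ x y') J t :=
  ((innerSL ℂ x).restrictScalars ℝ).hasFDerivAt.comp_hasDerivWithinAt t h

theorem hasDerivWithinAt_conj {y : ℝ → ℂ} {y' : ℂ} {t : ℝ} {J : Set ℝ}
    (h : HasDerivWithinAt y y' J t) : HasDerivWithinAt (fun t => conj (y t)) (conj y') J t :=
  (Complex.conjCLE.toContinuousLinearMap.hasFDerivAt).comp_hasDerivWithinAt t h

/-! ### The flow -/

/-- `K t e₀` solves the Calogero–Sutherland equation on `J`, where `K t` is the analytic Toeplitz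
operator with symbol `K t e₀` and `w = D K* K e₀` stands for `D₊ |u|²`. The operators depend
continuously on `t` in norm and stay bounded. -/
structure IsFlow (e : HilbertBasis ℕ ℂ H) (S : H →L[ℂ] H) (J : Set ℝ) (K N : ℝ → H →L[ℂ] H)
    (C : ℝ) : Prop where
  symbol : ∀ t, IsSymbol e S (K t) (N t)
  cont : Continuous K
  cont' : Continuous N
  bound : ∀ t, ‖K t‖ ≤ C
  bound' : ∀ t, ‖N t‖ ≤ C
  convex : Convex ℝ J
  zero_mem : (0 : ℝ) ∈ J
  equation : ∀ t ∈ J, ∃ w, IsNumber e (((K t)†) (K t (e 0))) w ∧ ∀ n : ℕ,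
    HasDerivWithinAt (fun τ => inner ℂ (e n) (K τ (e 0)))
      (Complex.I * (-(n : ℂ) ^ 2 * inner ℂ (e n) (K t (e 0)) + 2 * inner ℂ (e n) (K t w))) J t

namespace IsFlow

variable {e : HilbertBasis ℕ ℂ H} {S T : H →L[ℂ] H} {J : Set ℝ} {K N : ℝ → H →L[ℂ] H} {C ρ : ℝ}
variable (h : IsFlow e S J K N C)
include h

theorem nonneg : 0 ≤ C := (norm_nonneg _).trans (h.bound 0)

theorem continuous_adjoint : Continuous fun t => ((K t)†) :=
  (adjoint (𝕜 := ℂ) (E := H) (F := H)).continuous.comp h.cont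

theorem continuous_adjoint' : Continuous fun t => ((N t)†) :=
  (adjoint (𝕜 := ℂ) (E := H) (F := H)).continuous.comp h.cont'

theorem continuous_laxB : Continuous fun t => laxB (K t) (N t) := by
  have h1 := h.continuous_adjoint
  have h2 := h.continuous_adjoint'
  have h3 := h.cont
  have h4 := h.cont'
  unfold laxB
  fun_prop

theorem norm_laxB_le (t : ℝ) : ‖laxB (K t) (N t)‖ ≤ (C * C + C * C) + C * C * (C * C) := by
  have h0 := h.nonneg
  have h1 : ‖((K t)†)‖ ≤ C := by rw [LinearIsometryEquiv.norm_map]; exact h.bound t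
  have h2 : ‖((N t)†)‖ ≤ C := by rw [LinearIsometryEquiv.norm_map]; exact h.bound' t
  have h3 : ∀ {A B : H →L[ℂ] H} {a b : ℝ}, 0 ≤ a → ‖A‖ ≤ a → ‖B‖ ≤ b → ‖A * B‖ ≤ a * b :=
    fun ha hA hB => (norm_mul_le _ _).trans (mul_le_mul hA hB (norm_nonneg _) ha)
  have hI : ∀ A : H →L[ℂ] H, ‖Complex.I • A‖ = ‖A‖ := fun A => by
    rw [norm_smul, Complex.norm_I, one_mul]
  rw [laxB, neg_smul]
  refine (norm_add_le _ _).trans ?_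
  rw [norm_neg, hI, hI]
  refine add_le_add ((norm_add_le _ _).trans (add_le_add ?_ ?_)) ?_
  · exact h3 h0 (h.bound t) h2
  · exact h3 h0 (h.bound' t) h1
  · exact h3 (by positivity) (h3 h0 (h.bound t) h1) (h3 h0 (h.bound t) h1)

theorem continuous_resolventFactor : Continuous fun t => resolventFactor (K t) T := by
  have h1 := h.continuous_adjoint
  have h3 := h.cont
  unfold resolventFactor
  fun_prop

theorem continuous_inverse_resolventFactor (hρ : C * C < ρ) (hTn : ‖T‖ ≤ ρ⁻¹) :
    Continuous fun t => Ring.inverse (resolventFactor (K t) T) := by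
  refine continuous_iff_continuousAt.2 fun t => ?_
  obtain ⟨Z, hZ⟩ := isUnit_resolventFactor (h.bound t) hρ hTn
  have h1 := NormedRing.inverse_continuousAt Z
  rw [hZ] at h1
  exact ContinuousAt.comp (f := fun t => resolventFactor (K t) T) h1
    h.continuous_resolventFactor.continuousAt

/-- The time derivative of the matrix of `K`. -/
theorem hasDerivWithinAt_inner_basis {t : ℝ} (ht : t ∈ J) :
    ∃ w, IsNumber e (((K t)†) (K t (e 0))) w ∧ ∀ m l : ℕ,
      HasDerivWithinAt (fun τ => inner ℂ (e m) (K τ (e l)))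
        (Complex.I * (-((m : ℂ) - l) ^ 2 * inner ℂ (e m) (K t (e l))
          + 2 * inner ℂ (e m) (K t ((S ^ l) w)))) J t := by
  obtain ⟨w, hw, hd⟩ := h.equation t ht
  refine ⟨w, hw, fun m l => ?_⟩
  rw [(h.symbol t).inner_apply_shift_pow, (h.symbol t).inner_apply_basis]
  simp_rw [fun τ => (h.symbol τ).inner_apply_basis m l]
  split_ifs with hl
  · refine (hd (m - l)).congr_deriv ?_
    push_cast [hl]
    rfl
  · simpa using hasDerivWithinAt_const t J (0 : ℂ)

/-- The Lax equation, tested against basis vectors. -/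
theorem hasDerivWithinAt_inner_adjoint_basis {t : ℝ} (ht : t ∈ J) (m n : ℕ) :
    HasDerivWithinAt (fun τ => inner ℂ (((K τ)†) (e m)) (((K τ)†) (e n)))
      (inner ℂ ((m : ℂ) • e m - K t (((K t)†) (e m))) (laxB (K t) (N t) (e n))
        + inner ℂ (laxB (K t) (N t) (e m)) ((n : ℂ) • e n - K t (((K t)†) (e n)))) J t := by
  obtain ⟨w, hw, hd⟩ := h.hasDerivWithinAt_inner_basis ht
  have hL : ∀ τ, inner ℂ (((K τ)†) (e m)) (((K τ)†) (e n)) = ∑ l ∈ Finset.range (m + n + 1),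
      inner ℂ (e m) (K τ (e l)) * inner ℂ (K τ (e l)) (e n) := fun τ => by
    rw [inner_eq_sum_of_inner_eq_zero (e := e) (L := m + n + 1) (fun l hl =>
      (h.symbol τ).inner_adjoint_basis_of_lt (by omega))]
    simp only [adjoint_inner_left, adjoint_inner_right]
  rw [← (h.symbol t).laxEquation_basis hw m n (L := m + n + 1) (by omega) (by omega)]
  simp_rw [hL]
  refine HasDerivWithinAt.fun_sum fun l _ => (hd m l).mul ?_
  have := hasDerivWithinAt_conj (hd n l)
  simp only [map_mul, map_add, map_neg, map_sub, map_pow, Complex.conj_I, inner_conj_symm,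
    Complex.conj_natCast, map_ofNat] at this
  exact this

/-- `(D + ρ)⁻¹ K K* (D + ρ)⁻¹` is differentiable in norm. -/
theorem hasDerivWithinAt_sandwich (hT : IsNumberResolvent e ρ T) (hρ : 0 < ρ) {t : ℝ}
    (ht : t ∈ J) :
    HasDerivWithinAt (fun τ => T * (K τ * ((K τ)†)) * T)
      (star (resolventFactor (K t) T) * laxB (K t) (N t) * T
        - T * laxB (K t) (N t) * resolventFactor (K t) T) J t := by
  have hc : Continuous fun t => star (resolventFactor (K t) T) * laxB (K t) (N t) * T
        - T * laxB (K t) (N t) * resolventFactor (K t) T := by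
    have h1 := h.continuous_laxB
    have h2 := h.continuous_resolventFactor (T := T)
    fun_prop
  refine hasDerivWithinAt_of_weak (κ := ℕ × ℕ) h.convex hc
    (fun k => (coordFunctional e k.1) ∘L (ContinuousLinearMap.apply ℂ H (e k.2)).restrictScalars ℝ)
    (fun A hA => e.ext_clm fun n => e.ext_inner fun m => ?_) (fun k t ht => ?_) ht
  · have := hA (m, n)
    rw [zero_apply, inner_zero_right]
    exact this
  · obtain ⟨m, n⟩ := k
    have hT' : ∀ x y, inner ℂ x (T y) = inner ℂ (T x) y := fun x y => by
      rw [← adjoint_inner_right, hT.adjoint_eq]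
    have e1 : ∀ A : H →L[ℂ] H, ((coordFunctional e (m, n).1) ∘L
      (ContinuousLinearMap.apply ℂ H (e (m, n).2)).restrictScalars ℝ) A = inner ℂ (e m) (A (e n)) :=
      fun A => rfl
    simp only [e1]
    have e2 : ∀ τ, inner ℂ (e m) ((T * (K τ * ((K τ)†)) * T) (e n))
        = ((m : ℂ) + ρ)⁻¹ * ((n : ℂ) + ρ)⁻¹ * inner ℂ (((K τ)†) (e m)) (((K τ)†) (e n)) :=
        fun τ => by
      simp only [clm_mul_apply]
      rw [hT, e.diagonal_apply hT, map_smul, map_smul, inner_smul_right, adjoint_inner_left,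
        mul_assoc]
    simp_rw [e2]
    refine ((h.hasDerivWithinAt_inner_adjoint_basis ht m n).const_mul _).congr_deriv ?_
    have e3 : ∀ k : ℕ, ((k : ℂ) + ρ)⁻¹ • ((k : ℂ) • e k - K t (((K t)†) (e k)))
        = resolventFactor (K t) T (e k) - (ρ : ℂ) • T (e k) := fun k => by
      have h1 := isLax_apply_numberResolvent (K := K t) hT hρ (e k)
      rw [e.diagonal_apply hT k] at h1
      have h2 := IsNumber.isLax (K := K t) ((isNumber_basis e k).smul ((k : ℂ) + ρ)⁻¹)
      rw [e.diagonal_apply hT k]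
      rw [← h2.unique h1, map_smul, map_smul, smul_sub]
    have e4 : ∀ k : ℕ, conj (((k : ℂ) + ρ)⁻¹) = ((k : ℂ) + ρ)⁻¹ := fun k => by simp
    have e5 : ((m : ℂ) + ρ)⁻¹ * ((n : ℂ) + ρ)⁻¹ *
        (inner ℂ ((m : ℂ) • e m - K t (((K t)†) (e m))) (laxB (K t) (N t) (e n))
        + inner ℂ (laxB (K t) (N t) (e m)) ((n : ℂ) • e n - K t (((K t)†) (e n))))
        = inner ℂ (((m : ℂ) + ρ)⁻¹ • ((m : ℂ) • e m - K t (((K t)†) (e m))))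
            (laxB (K t) (N t) (T (e n)))
        + inner ℂ (laxB (K t) (N t) (T (e m)))
            (((n : ℂ) + ρ)⁻¹ • ((n : ℂ) • e n - K t (((K t)†) (e n)))) := by
      rw [e.diagonal_apply hT, e.diagonal_apply hT, map_smul, map_smul, inner_smul_left,
        inner_smul_right, inner_smul_left, inner_smul_right, e4]
      ring
    rw [e5, e3, e3, sub_apply, inner_sub_right, star_eq_adjoint]
    simp only [clm_mul_apply]
    rw [inner_sub_right (e m), adjoint_inner_right, hT' (e m), inner_sub_left, inner_smul_left,
      inner_smul_right, Complex.conj_ofReal, inner_laxB_left, inner_laxB_left]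
    ring

/-- The resolvent satisfies the Lax equation `∂ₜR = [B, R]`. -/
theorem hasDerivWithinAt_laxResolvent (hT : IsNumberResolvent e ρ T) (hρ : C * C < ρ)
    (hTn : ‖T‖ ≤ ρ⁻¹) {t : ℝ} (ht : t ∈ J) :
    HasDerivWithinAt (fun τ => laxResolvent (K τ) T)
      (laxB (K t) (N t) * laxResolvent (K t) T - laxResolvent (K t) T * laxB (K t) (N t)) J t := by
  have hρ0 : 0 < ρ := lt_of_le_of_lt (mul_self_nonneg C) hρ
  have hZ : ∀ τ, IsUnit (resolventFactor (K τ) T) := fun τ =>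
    isUnit_resolventFactor (h.bound τ) hρ hTn
  have hTs : star T = T := hT.adjoint_eq
  have hRs : ∀ τ, star (Ring.inverse (resolventFactor (K τ) T)) * T = laxResolvent (K τ) T :=
    fun τ => by
      have h1 : star (laxResolvent (K τ) T) = laxResolvent (K τ) T :=
        adjoint_laxResolvent hT hρ0 (hZ τ)
      rw [← h1, laxResolvent, star_mul, hTs]
  have hc := h.continuous_inverse_resolventFactor hρ hTn
  have hP := ((h.hasDerivWithinAt_sandwich hT hρ0 ht).sub_const
    (T * (K t * ((K t)†)) * T)).mul_const (Ring.inverse (resolventFactor (K t) T))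
  have hD := hasDerivWithinAt_of_eq_zero (β := fun x y : H →L[ℂ] H => y * x)
    (continuous_snd.mul continuous_fst) (fun a x y => mul_smul_comm a y x) hP
    (by rw [sub_self, zero_mul]) (hc.star.continuousWithinAt (s := J) (x := t))
  have hD2 := hD.add_const (laxResolvent (K t) T)
  -- The second resolvent identity, with the factors moved to isolate the differentiable increment.
  have key : ∀ τ, laxResolvent (K τ) T = star (Ring.inverse (resolventFactor (K τ) T)) *
      ((T * (K τ * ((K τ)†)) * T - T * (K t * ((K t)†)) * T) *
        Ring.inverse (resolventFactor (K t) T)) + laxResolvent (K t) T := fun τ => by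
    have h1 : T * (K τ * ((K τ)†)) * T - T * (K t * ((K t)†)) * T
        = T * resolventFactor (K t) T - star (resolventFactor (K τ) T) * T := by
      have h2 : star (resolventFactor (K τ) T) = 1 - T * (K τ * ((K τ)†)) := by
        rw [resolventFactor, star_sub, star_one, star_mul, hTs, star_mul, ← star_eq_adjoint,
          star_star]
      rw [h2, resolventFactor]
      noncomm_ring
    have h3 : star (Ring.inverse (resolventFactor (K τ) T)) * star (resolventFactor (K τ) T)
        = 1 := by
      rw [← star_mul, Ring.mul_inverse_cancel _ (hZ τ), star_one]
    rw [h1, sub_mul, mul_assoc T, Ring.mul_inverse_cancel _ (hZ t), mul_one, mul_sub,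
      hRs, mul_assoc _ T, ← mul_assoc (star _) (star _), h3, one_mul]
    change _ = laxResolvent (K τ) T - laxResolvent (K t) T + _
    rw [sub_add_cancel]
  refine (hD2.congr (fun τ _ => key τ) (key t)).congr_deriv ?_
  have h3 : star (Ring.inverse (resolventFactor (K t) T)) * star (resolventFactor (K t) T) = 1 := by
    rw [← star_mul, Ring.mul_inverse_cancel _ (hZ t), star_one]
  rw [sub_mul, mul_sub]
  congr 1
  · rw [mul_assoc (star (resolventFactor _ _)), mul_assoc (star (resolventFactor _ _)), ← mul_assoc,
      h3, one_mul, mul_assoc]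
    rfl
  · rw [mul_assoc _ (resolventFactor _ _), Ring.mul_inverse_cancel _ (hZ t), mul_one, ← mul_assoc,
      hRs]

end IsFlow

end Flow

section Formula

open ContinuousLinearMap
open scoped InnerProduct

variable {H : Type*} [NormedAddCommGroup H] [InnerProductSpace ℂ H] [CompleteSpace H]

/-! ### The explicit formula -/

theorem unitary_star_apply {U : H →L[ℂ] H} (hU : U ∈ unitary (H →L[ℂ] H)) (x : H) :
    star U (U x) = x := by
  rw [← clm_mul_apply, Unitary.star_mul_self_of_mem hU, clm_one_apply]

theorem unitary_apply_star {U : H →L[ℂ] H} (hU : U ∈ unitary (H →L[ℂ] H)) (x : H) :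
    U (star U x) = x := by
  rw [← clm_mul_apply, Unitary.mul_star_self_of_mem hU, clm_one_apply]

theorem unitary_inner {U : H →L[ℂ] H} (hU : U ∈ unitary (H →L[ℂ] H)) (x y : H) :
    inner ℂ (U x) (U y) = inner ℂ x y := by
  rw [← adjoint_inner_right, ← star_eq_adjoint, unitary_star_apply hU]

namespace IsFlow

variable {e : HilbertBasis ℕ ℂ H} {S T : H →L[ℂ] H} {J : Set ℝ} {K N : ℝ → H →L[ℂ] H} {C ρ : ℝ}
variable (h : IsFlow e S J K N C)
include h

/-- The propagator of `B` conjugates the Lax operators at different times. -/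
theorem isLax_propagator {U : ℝ → H →L[ℂ] H} (hU0 : U 0 = 1)
    (hU : ∀ t, HasDerivAt U (laxB (K t) (N t) * U t) t) (hUu : ∀ t, U t ∈ unitary (H →L[ℂ] H))
    {t : ℝ} (ht : t ∈ J) {f g : H} (hfg : IsLax e (K 0) f g) : IsLax e (K t) (U t f) (U t g) := by
  obtain ⟨ρ, hρ⟩ := exists_gt (C * C)
  have hρ0 : 0 < ρ := lt_of_le_of_lt (mul_self_nonneg C) hρ
  obtain ⟨T, hT, hTn⟩ := exists_isNumberResolvent e hρ0
  have hZ : ∀ τ, IsUnit (resolventFactor (K τ) T) := fun τ =>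
    isUnit_resolventFactor (h.bound τ) hρ hTn
  have hd : ∀ τ ∈ J, HasDerivWithinAt (fun τ => star (U τ) * (laxResolvent (K τ) T * U τ)) 0 J τ :=
    fun τ hτ => by
      have h1 := hasDerivAt_star (hU τ)
      rw [star_mul, star_laxB] at h1
      refine (h1.hasDerivWithinAt.mul ((h.hasDerivWithinAt_laxResolvent hT hρ hTn hτ).mul
        (hU τ).hasDerivWithinAt)).congr_deriv ?_
      simp only [Pi.mul_apply]
      noncomm_ring
  have h2 := eq_of_hasDerivWithinAt_zero h.convex hd h.zero_mem ht
  rw [hU0, star_one, one_mul, mul_one] at h2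
  have h3 : laxResolvent (K t) T * U t = U t * laxResolvent (K 0) T := by
    rw [← h2, ← mul_assoc, Unitary.mul_star_self_of_mem (hUu t), one_mul]
  have h4 := laxResolvent_apply hT hρ0 (hZ 0) hfg
  have h5 := isLax_laxResolvent hT hρ0 (hZ t) (U t (g + (ρ : ℂ) • f))
  rw [← clm_mul_apply, h3, clm_mul_apply, h4, map_add, map_smul, add_sub_cancel_right] at h5
  exact h5

/-- The equation `∂ₜu = B u - i L² u` in weak form, tested against an eigenvector of `L`. -/
theorem hasDerivWithinAt_inner_eigenvector {t : ℝ} (ht : t ∈ J) {g : H} {c : ℝ}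
    (hg : IsLax e (K t) g ((c : ℂ) • g)) :
    HasDerivWithinAt (fun τ => inner ℂ g (K τ (e 0)))
      (inner ℂ g (laxB (K t) (N t) (K t (e 0)))
        - Complex.I * (c : ℂ) ^ 2 * inner ℂ g (K t (e 0))) J t := by
  -- `T = (D + 1)⁻¹` regularizes the equation: `T u` is differentiable in norm.
  obtain ⟨T, hT, -⟩ := exists_isNumberResolvent e one_pos
  have hT' : ∀ x y, inner ℂ x (T y) = inner ℂ (T x) y := fun x y => by
    rw [← adjoint_inner_right, hT.adjoint_eq]
  let M : ℝ → H →L[ℂ] H := fun t => resolventFactor (K t) T - ((1 : ℝ) : ℂ) • T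
  let l : ℝ → H := fun t => N t (e 0) - K t (((K t)†) (K t (e 0)))
  have hl : ∀ t, IsLax e (K t) (K t (e 0)) (l t) := fun t => (h.symbol t).number.isLax
  have hM : ∀ t x, IsLax e (K t) (T x) (M t x) := fun t x =>
    isLax_apply_numberResolvent hT one_pos x
  let y' : ℝ → H := fun t => T (laxB (K t) (N t) (K t (e 0))) - Complex.I • star (M t) (l t)
  have hy' : ∀ t x, inner ℂ x (y' t) = inner ℂ (T x) (laxB (K t) (N t) (K t (e 0)))
      - Complex.I * inner ℂ (M t x) (l t) := fun t x => by
    rw [inner_sub_right, inner_smul_right, hT', star_eq_adjoint, adjoint_inner_right]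
  have hcont : Continuous y' := by
    have h1 := h.cont
    have h2 := h.cont'
    have h3 := h.continuous_adjoint
    have h4 := h.continuous_laxB
    have h5 : Continuous fun t => star (M t) :=
      (h.continuous_resolventFactor.sub continuous_const).star
    have h6 : Continuous l := by fun_prop
    exact (T.continuous.comp (h4.clm_apply (h1.clm_apply continuous_const))).sub
      ((h5.clm_apply h6).const_smul _)
  have hTu : HasDerivWithinAt (fun τ => T (K τ (e 0))) (y' t) J t := by
    refine hasDerivWithinAt_of_weak h.convex hcont (coordFunctional e)
      (coordFunctional_separating e) (fun n t ht => ?_) ht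
    simp only [coordFunctional_apply]
    rw [hy']
    simp only [hT' (e n), e.diagonal_apply hT n, inner_smul_left]
    obtain ⟨w, hw, hd⟩ := h.equation t ht
    refine ((hd n).const_mul _).congr_deriv ?_
    have h1 := (h.symbol t).form_eq (h.symbol t).number (isNumber_basis e n)
    have h2 := ((h.symbol t).number_adjoint (h.symbol t).number).unique hw
    have h3 : M t (e n) = ((n : ℂ) + (1 : ℝ))⁻¹ • ((n : ℂ) • e n - K t (((K t)†) (e n))) := by
      have h4 := IsNumber.isLax (K := K t) ((isNumber_basis e n).smul ((n : ℂ) + (1 : ℝ))⁻¹)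
      have h5 := hM t (e n)
      rw [e.diagonal_apply hT n] at h5
      rw [h5.unique h4, map_smul, map_smul, smul_sub]
    rw [h2, inner_smul_left _ (N t (e 0)), (h.symbol t).number n, Complex.conj_natCast,
      adjoint_inner_left] at h1
    rw [h3, inner_smul_left]
    simp only [l]
    linear_combination (-conj ((n : ℂ) + (1 : ℝ))⁻¹) * h1
  have hTg : T ((c : ℂ) • g + K t (((K t)†) g) + ((1 : ℝ) : ℂ) • g) = g :=
    hT.apply_number one_pos hg
  set φ := (c : ℂ) • g + K t (((K t)†) g) + ((1 : ℝ) : ℂ) • g with hφ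
  have h1 := hasDerivWithinAt_inner_const_left hTu φ
  simp only [hT', hTg] at h1
  refine h1.congr_deriv ?_
  have h2 := hM t φ
  rw [hTg] at h2
  have h3 := hg.inner_comm (hl t)
  rw [inner_smul_left, Complex.conj_ofReal] at h3
  rw [hy', hTg, h2.unique hg, inner_smul_left, Complex.conj_ofReal, ← h3]
  ring

/-- The explicit formula for the Fourier coefficients of the solution. -/
theorem inner_basis_eq {ι : Type*} (b : HilbertBasis ι ℂ H) {lam : ι → ℝ}
    (hb : ∀ i, IsLax e (K 0) (b i) ((lam i : ℂ) • b i)) {W : ℝ → H →L[ℂ] H}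
    (hW : ∀ τ i, W τ (b i) = Complex.exp (Complex.I * τ * lam i) • b i) {t : ℝ} (ht : t ∈ J)
    (k : ℕ) :
    inner ℂ (e k) (K t (e 0)) = inner ℂ (e 0)
      (((Complex.exp (-(Complex.I * t)) • (W (-2 * t) * S†)) ^ k) (K 0 (e 0))) := by
  have hSh := (h.symbol 0).shift
  obtain ⟨U, hU0, hU, hUu⟩ := exists_unitary_propagator h.continuous_laxB h.norm_laxB_le
    fun t => star_laxB (K t) (N t)
  have hdU : ∀ τ x, HasDerivWithinAt (fun τ => U τ x) (laxB (K τ) (N τ) (U τ x)) J τ :=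
    fun τ x => hasDerivWithinAt_clm_apply (hU τ).hasDerivWithinAt x
  have hLU : ∀ τ ∈ J, ∀ i, IsLax e (K τ) (U τ (b i)) ((lam i : ℂ) • U τ (b i)) := fun τ hτ i => by
    rw [← map_smul]; exact h.isLax_propagator hU0 hU hUu hτ (hb i)
  have hdUi : ∀ τ x (y : H), HasDerivWithinAt (fun τ => inner ℂ (U τ x) y)
      (inner ℂ (laxB (K τ) (N τ) (U τ x)) y) J τ := fun τ x y => by
    have := hasDerivWithinAt_conj (hasDerivWithinAt_inner_const_left (hdU τ x) y)
    simpa only [inner_conj_symm] using this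
  -- The coordinates of `U* u`.
  have hu : ∀ i, inner ℂ (U t (b i)) (K t (e 0))
      = Complex.exp (Complex.I * t * ((-lam i ^ 2 : ℝ) : ℂ)) * inner ℂ (b i) (K 0 (e 0)) := by
    intro i
    have hd : ∀ τ ∈ J, HasDerivWithinAt (fun τ => inner ℂ (U τ (b i)) (K τ (e 0)))
        (Complex.I * ((-lam i ^ 2 : ℝ) : ℂ) * inner ℂ (U τ (b i)) (K τ (e 0))) J τ := by
      intro τ hτ
      have h1 := h.hasDerivWithinAt_inner_eigenvector hτ (hLU τ hτ i)
      have h2 := hasDerivWithinAt_of_eq_zero (β := fun x y : H => inner ℂ x y) continuous_inner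
        (fun a x y => by
          rw [← Complex.coe_smul, inner_smul_left, Complex.conj_ofReal, Complex.real_smul])
        ((hdU τ (b i)).sub_const (U τ (b i))) (sub_self _)
        ((h.cont.clm_apply (continuous_const (y := e 0))).continuousWithinAt (s := J) (x := τ))
      refine ((h1.add h2).congr (fun r _ => ?_) ?_).congr_deriv ?_
      · simp
      · simp
      · rw [inner_laxB_left]
        push_cast
        ring
    have := eq_cexp_mul_of_hasDerivWithinAt h.convex h.zero_mem hd ht
    rwa [hU0] at this
  -- The coordinates of `U* e₀`, which solve the same equation since `A e₀ = 0`.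
  have h1 : ∀ i, inner ℂ (U t (b i)) (e 0)
      = Complex.exp (Complex.I * t * ((-lam i ^ 2 : ℝ) : ℂ)) * inner ℂ (b i) (e 0) := by
    intro i
    have hd : ∀ τ ∈ J, HasDerivWithinAt (fun τ => inner ℂ (U τ (b i)) (e 0))
        (Complex.I * ((-lam i ^ 2 : ℝ) : ℂ) * inner ℂ (U τ (b i)) (e 0)) J τ := by
      intro τ hτ
      refine (hdUi τ (b i) (e 0)).congr_deriv ?_
      have hg := hLU τ hτ i
      have h0 : IsNumber e (e 0) 0 := by simpa using isNumber_basis e 0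
      have h2 := (h.symbol τ).form_eq h0 hg
      have h3 : ((K τ)†) 0 - ((N τ)†) (e 0) = 0 := by
        -- `K* 1` is constant, so `D K* 1 = 0`.
        refine ((h.symbol τ).number_adjoint h0).unique fun n => ?_
        cases n with
        | zero => simp
        | succ n => simp [(h.symbol τ).inner_adjoint_basis_of_lt (Nat.succ_pos n)]
      have h4 := hg.inner_comm h0.isLax
      rw [inner_smul_left, Complex.conj_ofReal] at h4
      rw [h3, inner_zero_right, inner_zero_right, add_sub_cancel_right, inner_smul_left,
        Complex.conj_ofReal, ← h4] at h2
      rw [inner_laxB_left]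
      push_cast
      linear_combination -h2
    have := eq_cexp_mul_of_hasDerivWithinAt h.convex h.zero_mem hd ht
    rwa [hU0] at this
  -- The matrix of `U* S* U`.
  have hX : ∀ i j, inner ℂ (U t (b j)) ((S†) (U t (b i)))
      = Complex.exp (Complex.I * t * ((-((lam j + 1) ^ 2 - lam i ^ 2) : ℝ) : ℂ))
        * inner ℂ (b j) ((S†) (b i)) := by
    intro i j
    have hd : ∀ τ ∈ J, HasDerivWithinAt (fun τ => inner ℂ (U τ (b j)) ((S†) (U τ (b i))))
        (Complex.I * ((-((lam j + 1) ^ 2 - lam i ^ 2) : ℝ) : ℂ)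
          * inner ℂ (U τ (b j)) ((S†) (U τ (b i)))) J τ := by
      intro τ hτ
      have h2 := ((hdU τ (b j)).inner ℂ
        (((S†).restrictScalars ℝ).hasFDerivAt.comp_hasDerivWithinAt τ (hdU τ (b i))))
      refine h2.congr_deriv ?_
      refine ((h.symbol τ).inner_laxB_shift_adjoint (hLU τ hτ i) (hLU τ hτ j)).trans ?_
      push_cast
      ring
    have := eq_cexp_mul_of_hasDerivWithinAt h.convex h.zero_mem hd ht
    rwa [hU0] at this
  -- `G = e^{-itL²}` and `V = U t * G`.
  obtain ⟨G, hG, -⟩ := b.exists_diagonal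
    (fun i => Complex.exp (Complex.I * t * ((-lam i ^ 2 : ℝ) : ℂ))) zero_le_one
    fun i => (norm_cexp_I_mul t _).le
  have hGu : G ∈ unitary (H →L[ℂ] H) := b.diagonal_mem_unitary (fun i => norm_cexp_I_mul t _) hG
  have hWd : ∀ τ x i, inner ℂ (b i) (W τ x)
      = Complex.exp (Complex.I * τ * lam i) * inner ℂ (b i) x := by
    intro τ x i
    obtain ⟨W', hW', -⟩ := b.exists_diagonal (fun i => Complex.exp (Complex.I * τ * lam i))
      zero_le_one fun i => (norm_cexp_I_mul τ _).le
    rw [← hW', b.ext_clm (S := W τ) (T := W') fun i => by rw [hW, b.diagonal_apply hW']]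
  have hUs : ∀ (x : H) i, inner ℂ (b i) (star (U t) x) = inner ℂ (U t (b i)) x := fun x i => by
    rw [star_eq_adjoint, adjoint_inner_right]
  set Y := Complex.exp (-(Complex.I * t)) • (W (-2 * t) * S†) with hY
  have hVu : U t (G (K 0 (e 0))) = K t (e 0) := by
    rw [← unitary_apply_star (hUu t) (K t (e 0))]
    congr 1
    exact b.ext_inner fun i => by rw [hG, hUs, hu]
  have hV1 : U t (G (e 0)) = e 0 := by
    rw [← unitary_apply_star (hUu t) (e 0)]
    congr 1
    exact b.ext_inner fun i => by rw [unitary_apply_star (hUu t), hG, hUs, h1]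
  have hVY : (S†) * (U t * G) = U t * G * Y := by
    have h2 : star (U t) * (S†) * (U t) * G = G * Y := by
      refine b.ext_clm fun i => b.ext_inner fun j => ?_
      simp only [clm_mul_apply]
      rw [hUs, b.diagonal_apply hG, map_smul, map_smul, inner_smul_right, hX, hG, hY, smul_apply,
        inner_smul_right, clm_mul_apply, hWd, ← mul_assoc, ← mul_assoc, ← mul_assoc,
        ← Complex.exp_add, ← Complex.exp_add, ← Complex.exp_add]
      congr 2
      push_cast
      ring
    rw [mul_assoc (U t), ← h2]
    simp only [← mul_assoc]
    rw [Unitary.mul_star_self_of_mem (hUu t), one_mul]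
  have hpow : ∀ k : ℕ, (S†) ^ k * (U t * G) = U t * G * Y ^ k := fun k => by
    induction k with
    | zero => simp
    | succ k ih => rw [pow_succ, mul_assoc, hVY, ← mul_assoc, ih, mul_assoc, ← pow_succ]
  have hSk : ∀ (k : ℕ) (x : H), inner ℂ (e k) x = inner ℂ (e 0) (((S†) ^ k) x) := fun k => by
    induction k with
    | zero => simp
    | succ k ih => intro x; rw [← inner_shift_adjoint hSh, ih, pow_succ, clm_mul_apply]
  have hk := DFunLike.congr_fun (hpow k) (K 0 (e 0))
  simp only [clm_mul_apply] at hk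
  have hV : ∀ z, inner ℂ (e 0) (U t (G z)) = inner ℂ (e 0) z := fun z => by
    calc inner ℂ (e 0) (U t (G z)) = inner ℂ (U t (G (e 0))) (U t (G z)) := by rw [hV1]
      _ = inner ℂ (e 0) z := by rw [unitary_inner (hUu t), unitary_inner hGu]
  rw [hSk, ← hVu, hk, hV]

end IsFlow

theorem norm_le_one_of_inner {A : H →L[ℂ] H} (hA : ∀ x, inner ℂ (A x) (A x) = inner ℂ x x) :
    ‖A‖ ≤ 1 := by
  refine A.opNorm_le_bound zero_le_one fun x => ?_
  rw [one_mul, ← sq_le_sq₀ (norm_nonneg _) (norm_nonneg _), ← inner_self_eq_norm_sq (𝕜 := ℂ),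
    ← inner_self_eq_norm_sq (𝕜 := ℂ), hA]

/-- Neumann series, tested against vectors. -/
theorem isUnit_and_hasSum_neumann {Y : H →L[ℂ] H} (hY : ‖Y‖ ≤ 1) {z : ℂ} (hz : ‖z‖ < 1) (x y : H) :
    IsUnit (1 - z • Y) ∧
      HasSum (fun k : ℕ => inner ℂ y ((Y ^ k) x) * z ^ k)
        (inner ℂ y (Ring.inverse (1 - z • Y) x)) := by
  have hzY : ‖z • Y‖ < 1 := by
    rw [norm_smul]
    exact (mul_le_of_le_one_right (norm_nonneg _) hY).trans_lt hz
  refine ⟨(Units.oneSub _ hzY).isUnit, ?_⟩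
  have h1 := (summable_geometric_of_norm_lt_one hzY).hasSum
  have h2 : ∑' k : ℕ, (z • Y) ^ k = Ring.inverse (1 - z • Y) := by
    rw [NormedRing.inverse_one_sub _ hzY]; rfl
  rw [h2] at h1
  have h3 := ((innerSL ℂ y).comp (ContinuousLinearMap.apply ℂ H x)).hasSum h1
  refine h3.congr_fun fun k => ?_
  change _ = inner ℂ y (((z • Y) ^ k) x)
  rw [smul_pow, smul_apply, inner_smul_right, mul_comm]

end Formula

section Concrete

open ContinuousLinearMap
open scoped InnerProduct

/-! ### The Fourier basis of the Hardy space -/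

theorem L2T_ext {f g : L2T}
    (h : ∀ n, fourierCoeff (f : Torus → ℂ) n = fourierCoeff (g : Torus → ℂ) n) : f = g :=
  (fourierBasis (T := 2 * Real.pi)).repr.injective <| lp.ext <| funext fun n => by
    rw [repr_eq_fourierCoeff, repr_eq_fourierCoeff, h]

theorem fourierCoeff_congr_ae {f g : Torus → ℂ} (h : f =ᵐ[haarAddCircle] g) (n : ℤ) :
    fourierCoeff f n = fourierCoeff g n :=
  integral_congr_ae (h.mono fun x hx => by simp only [hx])

theorem inner_hardy (f g : hardy) : inner ℂ f g = inner ℂ (f : L2T) (g : L2T) := rfl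

theorem orthonormal_hardy :
    Orthonormal ℂ fun n : ℕ => (⟨fourierLp 2 n, fourierLp_mem_hardy n.cast_nonneg⟩ : hardy) := by
  have h := (orthonormal_fourier (T := 2 * Real.pi)).comp (fun n : ℕ => (n : ℤ)) Nat.cast_injective
  exact ⟨fun n => h.1 n, fun m n hmn => h.2 hmn⟩

/-- The basis `(e^{inx})_{n ≥ 0}` of the Hardy space. -/
def hardyBasis : HilbertBasis ℕ ℂ hardy :=
  HilbertBasis.mkOfOrthogonalEqBot orthonormal_hardy <| by
    rw [eq_bot_iff]
    intro f hf
    rw [Submodule.mem_orthogonal] at hf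
    refine (Submodule.mem_bot ℂ).2 (Subtype.ext (L2T_ext fun n => ?_))
    rw [ZeroMemClass.coe_zero, fourierCoeff_L2_zero]
    rcases lt_or_ge n 0 with hn | hn
    · exact f.2 n hn
    · lift n to ℕ using hn
      rw [fourierCoeff_L2_eq_inner]
      exact hf _ (Submodule.subset_span ⟨n, rfl⟩)

theorem coe_hardyBasis (n : ℕ) : (hardyBasis n : L2T) = fourierLp 2 n := by
  rw [hardyBasis, HilbertBasis.coe_mkOfOrthogonalEqBot]

theorem inner_hardyBasis (f : hardy) (n : ℕ) :
    inner ℂ (hardyBasis n) f = fourierCoeff (f : Torus → ℂ) n := by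
  rw [inner_hardy, coe_hardyBasis, fourierCoeff_L2_eq_inner]

theorem hardyBasis_zero : hardyBasis 0 = hardyOne := Subtype.ext (coe_hardyBasis 0)

theorem shift_hardyBasis (n : ℕ) : shift (hardyBasis n) = hardyBasis (n + 1) := by
  refine Subtype.ext (L2T_ext fun m => ?_)
  rw [show ((shift (hardyBasis n) : hardy) : L2T) = mulOp expI (hardyBasis n : L2T) from rfl,
    fourierCoeff_mulOp_expI, coe_hardyBasis, coe_hardyBasis, fourierCoeff_L2_eq_inner,
    fourierCoeff_L2_eq_inner]
  have h := orthonormal_iff_ite.mp (orthonormal_fourier (T := 2 * Real.pi))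
  rw [h, h]
  push_cast
  simp only [sub_eq_iff_eq_add]

/-! ### Toeplitz operators -/

theorem inner_mulOp_star (b : LinfT) (f g : L2T) :
    inner ℂ (mulOp (star b) f) g = inner ℂ f (mulOp b g) := by
  rw [L2.inner_def, L2.inner_def]
  refine integral_congr_ae ?_
  filter_upwards [coeFn_mulOp (star b) f, coeFn_mulOp b g, Lp.coeFn_star b] with x h1 h2 h3
  rw [h1, h2, h3]
  simp only [RCLike.inner_apply, Pi.star_apply, map_mul, RCLike.star_def, Complex.conj_conj]
  ring

theorem adjoint_toeplitz (b : LinfT) : adjoint (toeplitz b) = toeplitz (star b) := by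
  refine ContinuousLinearMap.ext fun f => ext_inner_right ℂ fun g => ?_
  rw [adjoint_inner_left]
  have h1 : inner ℂ f (toeplitz b g) = inner ℂ (f : L2T) (mulOp b g) :=
    Submodule.inner_orthogonalProjectionOnto_eq_of_mem_left f _
  have h2 : inner ℂ (toeplitz (star b) f) g = inner ℂ (mulOp (star b) f) (g : L2T) :=
    Submodule.inner_orthogonalProjectionOnto_eq_of_mem_right g _
  rw [h1, h2, inner_mulOp_star]

theorem inner_hardyBasis_toeplitz (b : LinfT) (f : hardy) (n : ℕ) :
    inner ℂ (hardyBasis n) (toeplitz b f) = fourierCoeff (mulOp b f : Torus → ℂ) n := by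
  rw [inner_hardyBasis]
  exact (fourierCoeff_szego _ _).trans (if_pos n.cast_nonneg)

theorem fourierCoeff_mulOp_star_fourierLp (b : LinfT) (m n : ℤ) :
    fourierCoeff (mulOp (star b) (fourierLp 2 n) : Torus → ℂ) m
      = conj (fourierCoeff (b : Torus → ℂ) (n - m)) := by
  unfold fourierCoeff
  rw [← integral_conj]
  refine integral_congr_ae ?_
  filter_upwards [coeFn_mulOp (star b) (fourierLp 2 n), coeFn_fourierLp (T := 2 * Real.pi) 2 n,
    Lp.coeFn_star b] with x h1 h2 h3
  rw [h1, h2, h3, show -(n - m) = -n + m by ring, fourier_add, fourier_neg, fourier_neg]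
  simp only [smul_eq_mul, Pi.star_apply, RCLike.star_def, map_mul, Complex.conj_conj]
  ring

/-- The product of two functions without negative frequencies has no negative frequencies. -/
theorem mulOp_mem_hardy {b : LinfT} (hb : ∀ n : ℤ, n < 0 → fourierCoeff (b : Torus → ℂ) n = 0)
    (f : hardy) : mulOp b f ∈ hardy := fun n hn => by
  rw [fourierCoeff_L2_eq_inner, ← inner_mulOp_star,
    ← (fourierBasis (T := 2 * Real.pi)).tsum_inner_mul_inner]
  refine (tsum_congr fun m => ?_).trans tsum_zero
  rw [coe_fourierBasis, ← fourierCoeff_L2_eq_inner]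
  rcases lt_or_ge m 0 with hm | hm
  · rw [f.2 m hm, mul_zero]
  · rw [← inner_conj_symm, ← fourierCoeff_L2_eq_inner, fourierCoeff_mulOp_star_fourierLp,
      hb _ (by omega), map_zero, map_zero, zero_mul]

theorem toeplitz_comm_shift {b : LinfT} (hb : ∀ n : ℤ, n < 0 → fourierCoeff (b : Torus → ℂ) n = 0) :
    toeplitz b * shift = shift * toeplitz b := by
  have hcoe : ∀ f : hardy, ((toeplitz b f : hardy) : L2T) = mulOp b f := fun f => by
    refine L2T_ext fun n => (fourierCoeff_szego _ _).trans ?_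
    split_ifs with hn
    · rfl
    · exact (mulOp_mem_hardy hb f n (not_le.1 hn)).symm
  refine ContinuousLinearMap.ext fun f => Subtype.ext (Lp.ext ?_)
  rw [clm_mul_apply, clm_mul_apply, hcoe]
  change _ =ᵐ[haarAddCircle] (mulOp expI (toeplitz b f : hardy) : L2T)
  rw [hcoe]
  change (mulOp b (mulOp expI (f : L2T)) : L2T) =ᵐ[haarAddCircle] _
  filter_upwards [coeFn_mulOp b (mulOp expI (f : L2T)), coeFn_mulOp expI (f : L2T),
    coeFn_mulOp expI (mulOp b (f : L2T)), coeFn_mulOp b (f : L2T)] with x h1 h2 h3 h4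
  rw [h1, h2, h3, h4]
  ring

theorem coeFn_toLinf {s : ℝ} (hs : 1 / 2 < s) {f : L2T} (hf : f ∈ sobolev s) :
    (toLinf hs hf : Torus → ℂ) =ᵐ[haarAddCircle] f := MemLp.coeFn_toLp _

theorem inner_hardyBasis_toeplitz_toLinf {s : ℝ} (hs : 1 / 2 < s) {u : L2T} (hu : u ∈ sobolev s)
    (f : hardy) (n : ℕ) : inner ℂ (hardyBasis n) (toeplitz (toLinf hs hu) f)
      = fourierCoeff (fun x => u x * (f : L2T) x) n := by
  rw [inner_hardyBasis_toeplitz]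
  refine fourierCoeff_congr_ae ?_ _
  filter_upwards [coeFn_mulOp (toLinf hs hu) (f : L2T), coeFn_toLinf hs hu] with x h1 h2
  rw [h1, h2]

theorem toeplitz_toLinf_basis_zero {s : ℝ} (hs : 1 / 2 < s) {u : hardy}
    (hu : (u : L2T) ∈ sobolev s) :
    toeplitz (toLinf hs hu) (hardyBasis 0) = u := hardyBasis.ext_inner fun n => by
  rw [inner_hardyBasis_toeplitz_toLinf, inner_hardyBasis, hardyBasis_zero]
  refine fourierCoeff_congr_ae ?_ _
  filter_upwards [coeFn_hardyOne] with x h1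
  rw [h1, mul_one]

theorem inner_hardyBasis_adjoint_toeplitz {s : ℝ} (hs : 1 / 2 < s) {u : hardy}
    (hu : (u : L2T) ∈ sobolev s) (n : ℕ) :
    inner ℂ (hardyBasis n) (adjoint (toeplitz (toLinf hs hu)) u)
      = fourierCoeff (fun x => ((‖(u : L2T) x‖ ^ 2 : ℝ) : ℂ)) n := by
  rw [adjoint_toeplitz, inner_hardyBasis_toeplitz]
  refine fourierCoeff_congr_ae ?_ _
  filter_upwards [coeFn_mulOp (star (toLinf hs hu)) (u : L2T), coeFn_toLinf hs hu,
    Lp.coeFn_star (toLinf hs hu)] with x h1 h2 h3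
  rw [h1, h3, Pi.star_apply, h2, RCLike.star_def, RCLike.conj_mul]
  norm_cast

/-! ### The symbol and its derivative -/

theorem sobolevTerm_derivL2_le (s : ℝ) (f : sobolev 1) (n : ℤ) :
    sobolevTerm (s - 1) (derivL2 f) n ≤ sobolevTerm s f n := by
  have h0 : (0 : ℝ) < 1 + (n : ℝ) ^ 2 := by positivity
  have h1 : (1 + (n : ℝ) ^ 2) ^ s = (1 + (n : ℝ) ^ 2) ^ (s - 1) * (1 + (n : ℝ) ^ 2) := by
    rw [← Real.rpow_add_one h0.ne', sub_add_cancel]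
  simp only [sobolevTerm]
  rw [fourierCoeff_derivL2, norm_mul, mul_pow, Complex.norm_intCast, sq_abs, h1, mul_assoc]
  gcongr
  linarith

theorem sobolev_mono {r s : ℝ} (h : r ≤ s) : sobolev s ≤ sobolev r := fun f hf => by
  refine Summable.of_nonneg_of_le (sobolevTerm_nonneg r f) (fun n => ?_) hf
  unfold sobolevTerm
  gcongr
  nlinarith [sq_nonneg (n : ℝ)]

theorem derivL2_mem_sobolev {s : ℝ} (f : sobolev 1) (hf : (f : L2T) ∈ sobolev s) :
    derivL2 f ∈ sobolev (s - 1) :=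
  Summable.of_nonneg_of_le (sobolevTerm_nonneg _ _) (sobolevTerm_derivL2_le s f) hf

theorem mem_sobolev_one {s : ℝ} (hs : 3 / 2 < s) {f : L2T} (hf : f ∈ sobolev s) : f ∈ sobolev 1 :=
  sobolev_mono (by linarith) hf

/-- The derivative `D f ∈ L^∞` of `f ∈ H^s`, `s > 3/2`. -/
def derivLinf {s : ℝ} (hs : 3 / 2 < s) {f : L2T} (hf : f ∈ sobolev s) : LinfT :=
  toLinf (s := s - 1) (by linarith) (derivL2_mem_sobolev ⟨f, mem_sobolev_one hs hf⟩ hf)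

theorem isSymbol_toeplitz {s : ℝ} (hs : 3 / 2 < s) (hs' : 1 / 2 < s) {u : hardy}
    (hu : (u : L2T) ∈ sobolev s) :
    IsSymbol hardyBasis shift (toeplitz (toLinf hs' hu)) (toeplitz (derivLinf hs hu)) where
  shift := shift_hardyBasis
  comm := toeplitz_comm_shift fun n hn => by
    rw [fourierCoeff_congr_ae (coeFn_toLinf hs' hu), u.2 n hn]
  comm' := toeplitz_comm_shift fun n hn => by
    rw [derivLinf, fourierCoeff_congr_ae (coeFn_toLinf _ _), fourierCoeff_derivL2, u.2 n hn,
      mul_zero]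
  number n := by
    have h := toeplitz_toLinf_basis_zero (s := s - 1) (by linarith)
      (u := ⟨_, derivL2_mem_hardy (mem_sobolev_one hs hu) u.2⟩)
      (derivL2_mem_sobolev ⟨u, mem_sobolev_one hs hu⟩ hu)
    rw [toeplitz_toLinf_basis_zero, derivLinf, h, inner_hardyBasis, inner_hardyBasis,
      fourierCoeff_derivL2]
    simp

/-! ### The Lax operator -/

theorem mem_graph_laxOp (b : LinfT) (f g : hardy) :
    (f, g) ∈ (laxOp b).graph ↔ IsLax hardyBasis (toeplitz b) f g := by
  have happly : ∀ x : hardySobolev 1, laxOp b x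
      = derivHardy x - toeplitz b (adjoint (toeplitz b) (x : hardy)) := fun x => by
    rw [adjoint_toeplitz]; rfl
  have hcoeff : ∀ (x : hardySobolev 1) (n : ℤ),
      fourierCoeff ((derivHardy x : hardy) : Torus → ℂ) n
        = n * fourierCoeff ((x : hardy) : Torus → ℂ) n := fun x n =>
    fourierCoeff_derivL2 ⟨((x : hardy) : L2T), x.2⟩ n
  rw [LinearPMap.mem_graph_iff]
  constructor
  · rintro ⟨x, rfl, rfl⟩
    intro n
    have hx : laxOp b x + toeplitz b (adjoint (toeplitz b) (x : hardy)) = derivHardy x :=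
      (congrArg (· + _) (happly x)).trans (sub_add_cancel _ _)
    rw [hx, inner_hardyBasis, inner_hardyBasis]
    exact (hcoeff x n).trans (by simp)
  · intro h
    set z := g + toeplitz b (adjoint (toeplitz b) f) with hz
    have hzc : ∀ n : ℤ, fourierCoeff (z : Torus → ℂ) n = n * fourierCoeff (f : Torus → ℂ) n := by
      intro n
      rcases lt_or_ge n 0 with hn | hn
      · rw [z.2 n hn, f.2 n hn, mul_zero]
      · lift n to ℕ using hn
        have := h n
        rw [← hz, inner_hardyBasis, inner_hardyBasis] at this
        rw [this]
        simp
    have hsum : ∀ x : L2T, Summable fun n : ℤ => ‖fourierCoeff (x : Torus → ℂ) n‖ ^ 2 := fun x => by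
      have := ((fourierBasis (T := 2 * Real.pi)).hasSum_norm_inner_sq x).summable
      simpa only [coe_fourierBasis, ← fourierCoeff_L2_eq_inner] using this
    have hf : f ∈ hardySobolev 1 := by
      change Summable (sobolevTerm 1 f)
      refine ((hsum f).add (hsum z)).congr fun n => ?_
      rw [hzc, sobolevTerm, norm_mul, mul_pow, Complex.norm_intCast, sq_abs, Real.rpow_one]
      ring
    refine ⟨⟨f, hf⟩, rfl, ?_⟩
    refine (happly ⟨f, hf⟩).trans (sub_eq_iff_eq_add.2 ?_)
    rw [← hz]
    exact Subtype.ext (L2T_ext fun n => (hcoeff _ n).trans (hzc n).symm)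

end Concrete

section Continuity

open ContinuousLinearMap
open scoped InnerProduct

/-! ### Continuous dependence of Toeplitz operators on the symbol -/

theorem ae_norm_le_tsum_fourierCoeff {f : L2T}
    (hsum : Summable fun n : ℤ => ‖fourierCoeff (f : Torus → ℂ) n‖) :
    ∀ᵐ x ∂(haarAddCircle : Measure Torus), ‖f x‖ ≤ ∑' n : ℤ, ‖fourierCoeff (f : Torus → ℂ) n‖ := by
  have hn : ∀ n : ℤ, ‖fourierCoeff (f : Torus → ℂ) n • (fourier n : C(Torus, ℂ))‖
      = ‖fourierCoeff (f : Torus → ℂ) n‖ := fun n => by rw [norm_smul, fourier_norm, mul_one]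
  have hsum' : Summable fun n : ℤ =>
      ‖fourierCoeff (f : Torus → ℂ) n • (fourier n : C(Torus, ℂ))‖ := by simpa only [hn] using hsum
  set F : C(Torus, ℂ) := ∑' n : ℤ, fourierCoeff (f : Torus → ℂ) n • (fourier n : C(Torus, ℂ))
    with hF
  have hFn : ‖F‖ ≤ ∑' n : ℤ, ‖fourierCoeff (f : Torus → ℂ) n‖ :=
    (norm_tsum_le_tsum_norm hsum').trans_eq (tsum_congr hn)
  have h2 := (ContinuousMap.toLp (E := ℂ) 2 (haarAddCircle : Measure Torus) ℂ).hasSum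
    (Summable.of_norm hsum').hasSum
  have h4 : ContinuousMap.toLp (E := ℂ) 2 (haarAddCircle : Measure Torus) ℂ F = f := by
    refine h2.unique ?_
    convert hasSum_fourier_series_L2 f using 2 with n
    simp [fourierLp]
  have h5 : (f : Torus → ℂ) =ᵐ[haarAddCircle] F := by
    rw [← h4]
    exact ContinuousMap.coeFn_toLp _ _
  filter_upwards [h5] with x hx
  rw [hx]
  exact (F.norm_coe_le_norm x).trans hFn

theorem summable_one_add_sq_rpow {s : ℝ} (hs : 1 / 2 < s) :
    Summable fun n : ℤ => (1 + (n : ℝ) ^ 2) ^ (-s) := by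
  have h : Summable fun n : ℤ => |(n : ℝ)| ^ (-(2 * s)) :=
    Real.summable_abs_int_rpow (by linarith)
  refine Summable.of_norm_bounded_eventually h ?_
  filter_upwards [(Set.finite_singleton (0 : ℤ)).compl_mem_cofinite] with n hn
  have hn0 : (n : ℝ) ≠ 0 := by exact_mod_cast hn
  have hp : 0 < (n : ℝ) ^ 2 := by positivity
  rw [Real.norm_of_nonneg (by positivity), show -(2 * s) = 2 * (-s) by ring,
    Real.rpow_mul (abs_nonneg _), Real.rpow_two, sq_abs]
  exact Real.rpow_le_rpow_of_nonpos hp (by linarith) (by linarith)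

/-- The constant of the Sobolev embedding `H^s(𝕋) ⊆ L^∞(𝕋)`, `s > 1/2`. -/
def sobolevConst (s : ℝ) : ℝ := √(∑' n : ℤ, (1 + (n : ℝ) ^ 2) ^ (-s))

theorem tsum_norm_fourierCoeff_le {s : ℝ} (hs : 1 / 2 < s) {f : L2T} (hf : f ∈ sobolev s) :
    ∑' n : ℤ, ‖fourierCoeff (f : Torus → ℂ) n‖ ≤ sobolevConst s * sobolevNorm s f := by
  refine (summable_fourierCoeff_of_mem_sobolev hs hf).norm.tsum_le_of_sum_le fun t => ?_
  have h := Real.sum_mul_le_sqrt_mul_sqrt t (fun n : ℤ => (1 + (n : ℝ) ^ 2) ^ (-s / 2))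
    (fun n => (1 + (n : ℝ) ^ 2) ^ (s / 2) * ‖fourierCoeff (f : Torus → ℂ) n‖)
  have hb : ∀ n : ℤ, (0 : ℝ) < 1 + (n : ℝ) ^ 2 := fun n => by positivity
  have hsq : ∀ (n : ℤ) (r : ℝ), ((1 + (n : ℝ) ^ 2) ^ (r / 2)) ^ 2 = (1 + (n : ℝ) ^ 2) ^ r :=
    fun n r => by
      rw [← Real.rpow_two, ← Real.rpow_mul (hb n).le, div_mul_cancel₀ r two_ne_zero]
  have hmul : ∀ n : ℤ, (1 + (n : ℝ) ^ 2) ^ (-s / 2) * (1 + (n : ℝ) ^ 2) ^ (s / 2) = 1 :=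
    fun n => by rw [← Real.rpow_add (hb n), neg_div, neg_add_cancel, Real.rpow_zero]
  simp only [← mul_assoc, hmul, one_mul, mul_pow, hsq] at h
  refine h.trans ?_
  unfold sobolevConst sobolevNorm
  gcongr
  · exact (summable_one_add_sq_rpow hs).sum_le_tsum _ fun n _ => Real.rpow_nonneg (hb n).le _
  · exact Summable.sum_le_tsum t (fun n _ => sobolevTerm_nonneg s f n) hf

theorem norm_toLinf_le {s : ℝ} (hs : 1 / 2 < s) {f : L2T} (hf : f ∈ sobolev s) :
    ‖toLinf hs hf‖ ≤ sobolevConst s * sobolevNorm s f := by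
  have h0 : 0 ≤ sobolevConst s * sobolevNorm s f :=
    mul_nonneg (Real.sqrt_nonneg _) (Real.sqrt_nonneg _)
  refine (Lp.norm_le_of_ae_bound h0 ?_).trans_eq ?_
  · filter_upwards [coeFn_toLinf hs hf,
      ae_norm_le_tsum_fourierCoeff (summable_fourierCoeff_of_mem_sobolev hs hf).norm] with x h1 h2
    rw [h1]
    exact h2.trans (tsum_norm_fourierCoeff_le hs hf)
  · simp

theorem toLinf_sub {s : ℝ} (hs : 1 / 2 < s) {f g : L2T} (hf : f ∈ sobolev s) (hg : g ∈ sobolev s) :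
    toLinf hs ((sobolev s).sub_mem hf hg) = toLinf hs hf - toLinf hs hg := by
  refine Lp.ext ?_
  filter_upwards [coeFn_toLinf hs ((sobolev s).sub_mem hf hg), coeFn_toLinf hs hf,
    coeFn_toLinf hs hg, Lp.coeFn_sub (toLinf hs hf) (toLinf hs hg), Lp.coeFn_sub f g]
    with x h1 h2 h3 h4 h5
  rw [h1, h4, Pi.sub_apply, h2, h3, h5, Pi.sub_apply]

theorem toeplitz_sub (b c : LinfT) : toeplitz (b - c) = toeplitz b - toeplitz c := by
  unfold toeplitz mulOp
  rw [map_sub]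
  ext x
  simp

theorem norm_mulOp_le (b : LinfT) (f : L2T) : ‖mulOp b f‖ ≤ ‖b‖ * ‖f‖ := by
  refine (ContinuousLinearMap.norm_holder_apply_apply_le (ContinuousLinearMap.mul ℂ ℂ) b f).trans ?_
  gcongr
  exact mul_le_of_le_one_left (norm_nonneg _) (opNorm_mul_le ℂ ℂ)

theorem norm_toeplitz_le (b : LinfT) : ‖toeplitz b‖ ≤ ‖b‖ :=
  opNorm_le_bound _ (norm_nonneg b) fun f =>
    (Submodule.norm_orthogonalProjectionOnto_apply_le hardy (mulOp b f)).trans (norm_mulOp_le b f)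

theorem sobolevNorm_derivL2_le {s : ℝ} {f : L2T} (h1 : f ∈ sobolev 1) (hf : f ∈ sobolev s) :
    sobolevNorm (s - 1) (derivL2 ⟨f, h1⟩) ≤ sobolevNorm s f :=
  Real.sqrt_le_sqrt <| Summable.tsum_le_tsum (sobolevTerm_derivL2_le s ⟨f, h1⟩)
    (derivL2_mem_sobolev ⟨f, h1⟩ hf) hf

theorem norm_toeplitz_toLinf_sub_le {s : ℝ} (hs : 1 / 2 < s) {f g : L2T} (hf : f ∈ sobolev s)
    (hg : g ∈ sobolev s) : ‖toeplitz (toLinf hs hf) - toeplitz (toLinf hs hg)‖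
      ≤ sobolevConst s * sobolevNorm s (f - g) := by
  rw [← toeplitz_sub, ← toLinf_sub]
  exact (norm_toeplitz_le _).trans (norm_toLinf_le _ _)

theorem norm_toeplitz_derivLinf_sub_le {s : ℝ} (hs : 3 / 2 < s) {f g : L2T} (hf : f ∈ sobolev s)
    (hg : g ∈ sobolev s) : ‖toeplitz (derivLinf hs hf) - toeplitz (derivLinf hs hg)‖
      ≤ sobolevConst (s - 1) * sobolevNorm s (f - g) := by
  refine (norm_toeplitz_toLinf_sub_le _ _ _).trans ?_
  rw [← map_sub]
  exact mul_le_mul_of_nonneg_left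
    (sobolevNorm_derivL2_le _ ((sobolev s).sub_mem hf hg)) (Real.sqrt_nonneg _)

end Continuity

section Resolvent

open ContinuousLinearMap
open scoped InnerProduct

variable {H : Type*} [NormedAddCommGroup H] [InnerProductSpace ℂ H] [CompleteSpace H]
variable {e : HilbertBasis ℕ ℂ H} {S : H →L[ℂ] H} {J : Set ℝ} {K N : ℝ → H →L[ℂ] H} {C : ℝ}

/-! ### The generating series of a flow -/

/-- The generating series of the coefficients of a flow, as a resolvent: the powers in
`IsFlow.inner_basis_eq` are those of a contraction. -/
theorem IsFlow.isUnit_and_hasSum (h : IsFlow e S J K N C) {ι : Type*} (b : HilbertBasis ι ℂ H)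
    {lam : ι → ℝ} (hb : ∀ i, IsLax e (K 0) (b i) ((lam i : ℂ) • b i)) {W : ℝ → H →L[ℂ] H}
    (hW : ∀ τ i, W τ (b i) = Complex.exp (Complex.I * τ * lam i) • b i)
    (hWu : ∀ τ, W τ ∈ unitary (H →L[ℂ] H)) {t : ℝ} (ht : t ∈ J) {z : ℂ} (hz : ‖z‖ < 1) :
    IsUnit (1 - (z * Complex.exp (-(Complex.I * t))) • (W (-2 * t) * S†)) ∧
      HasSum (fun k : ℕ => inner ℂ (e k) (K t (e 0)) * z ^ k)
        (inner ℂ (e 0) (Ring.inverse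
          (1 - (z * Complex.exp (-(Complex.I * t))) • (W (-2 * t) * S†)) (K 0 (e 0)))) := by
  have hY : ‖Complex.exp (-(Complex.I * t)) • (W (-2 * t) * S†)‖ ≤ 1 := by
    have h1 : ‖Complex.exp (-(Complex.I * t))‖ = 1 := by
      rw [Complex.norm_exp]; simp
    have h2 : ‖W (-2 * t)‖ ≤ 1 := norm_le_one_of_inner fun x => unitary_inner (hWu _) x x
    have h3 : ‖(S†)‖ ≤ 1 := by
      rw [LinearIsometryEquiv.norm_map]
      exact norm_le_one_of_inner fun x => inner_shift_shift (h.symbol 0).shift x x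
    rw [norm_smul, h1, one_mul]
    exact (norm_mul_le _ _).trans (mul_le_one₀ h2 (norm_nonneg _) h3)
  have hmain := isUnit_and_hasSum_neumann hY hz (K 0 (e 0)) (e 0)
  rw [smul_smul] at hmain
  simpa only [h.inner_basis_eq b hb hW ht] using hmain

end Resolvent

section Solutions

open ContinuousLinearMap
open scoped InnerProduct

variable {s : ℝ} {I : Set ℝ} {u : ℝ → hardy}

/-! ### Solutions of the equation as flows -/

/-- Continuity in time, from a Lipschitz bound by the `H^s` norm. -/
theorem IsSolution.continuous_of_norm_sub_le (h : IsSolution s I u) {X E : Type*}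
    [TopologicalSpace X] [SeminormedAddCommGroup E] {p : X → ℝ} (hp : Continuous p)
    (hpI : ∀ x, p x ∈ I) {F : X → E} {C : ℝ}
    (hF : ∀ x y, ‖F x - F y‖ ≤ C * sobolevNorm s ((u (p x) - u (p y) : hardy) : L2T)) :
    Continuous F := by
  refine continuous_iff_continuousAt.2 fun y => tendsto_iff_norm_sub_tendsto_zero.2 ?_
  have hp' : Filter.Tendsto p (𝓝 y) (𝓝[I] (p y)) :=
    tendsto_nhdsWithin_iff.2 ⟨hp.continuousAt, Filter.Eventually.of_forall hpI⟩
  have h1 := ((h.continuous (p y) (hpI y)).comp hp').const_mul C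
  rw [mul_zero] at h1
  exact squeeze_zero (fun x => norm_nonneg _) (fun x => hF x y) h1

theorem exists_norm_comp_projIcc_le {E : Type*} [SeminormedAddCommGroup E] {a b : ℝ} (hab : a ≤ b)
    {F : Set.Icc a b → E} (hF : Continuous F) : ∃ C, ∀ τ, ‖F (Set.projIcc a b hab τ)‖ ≤ C := by
  obtain ⟨C, hC⟩ := isCompact_univ.exists_bound_of_continuousOn (hF.continuousOn (s := Set.univ))
  exact ⟨C, fun τ => hC _ (Set.mem_univ _)⟩

/-- A solution on a compact interval around `0`, frozen outside of it, provides a flow. -/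
theorem IsSolution.exists_isFlow (h : IsSolution s I u) (hs : 3 / 2 < s) (hs' : 1 / 2 < s) {a b : ℝ}
    (hab : a ≤ b) (hJ : Set.Icc a b ⊆ I) (h0 : (0 : ℝ) ∈ Set.Icc a b) :
    ∃ K N C, IsFlow hardyBasis shift (Set.Icc a b) K N C ∧
      (∀ τ ∈ Set.Icc a b, K τ (hardyBasis 0) = u τ) ∧
      K 0 = toeplitz (toLinf (f := u 0) hs' (h.mem 0 (hJ h0))) := by
  have hmem : ∀ τ ∈ I, (u τ : L2T) ∈ sobolev s := h.mem
  obtain ⟨K, hKd⟩ : ∃ K : Set.Icc a b → hardy →L[ℂ] hardy,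
      ∀ τ, K τ = toeplitz (toLinf hs' (hmem τ (hJ τ.2))) := ⟨_, fun _ => rfl⟩
  obtain ⟨N, hNd⟩ : ∃ N : Set.Icc a b → hardy →L[ℂ] hardy,
      ∀ τ, N τ = toeplitz (derivLinf hs (hmem τ (hJ τ.2))) := ⟨_, fun _ => rfl⟩
  have hK : Continuous K := h.continuous_of_norm_sub_le (E := hardy →L[ℂ] hardy)
    continuous_subtype_val (fun τ => hJ τ.2) fun x y => by
      rw [hKd, hKd]; exact norm_toeplitz_toLinf_sub_le _ _ _
  have hN : Continuous N := h.continuous_of_norm_sub_le (E := hardy →L[ℂ] hardy)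
    continuous_subtype_val (fun τ => hJ τ.2) fun x y => by
      rw [hNd, hNd]; exact norm_toeplitz_derivLinf_sub_le _ _ _
  obtain ⟨C₁, h1⟩ := exists_norm_comp_projIcc_le (E := hardy →L[ℂ] hardy) hab hK
  obtain ⟨C₂, h2⟩ := exists_norm_comp_projIcc_le (E := hardy →L[ℂ] hardy) hab hN
  have hK0 : ∀ τ, K (Set.projIcc a b hab τ) (hardyBasis 0) = u (Set.projIcc a b hab τ) :=
    fun τ => by rw [hKd, toeplitz_toLinf_basis_zero]
  refine ⟨fun τ => K (Set.projIcc a b hab τ), fun τ => N (Set.projIcc a b hab τ), max C₁ C₂,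
    { symbol := fun τ => by rw [hKd, hNd]; exact isSymbol_toeplitz hs hs' _
      cont := hK.comp continuous_projIcc
      cont' := hN.comp continuous_projIcc
      bound := fun τ => (h1 τ).trans (le_max_left _ _)
      bound' := fun τ => (h2 τ).trans (le_max_right _ _)
      convex := convex_Icc a b
      zero_mem := h0
      equation := fun t ht => ?_ }, fun τ hτ => ?_, ?_⟩
  rotate_left
  · rw [hK0, Set.projIcc_of_mem hab hτ]
  · rw [← hKd ⟨0, h0⟩, ← Set.projIcc_of_mem hab h0]
  obtain ⟨w, hw, hd⟩ := h.equation t (hJ ht)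
  have hwm : w ∈ hardy := fun n hn => by rw [hw n, if_neg (not_le.2 hn)]
  have hpt : (Set.projIcc a b hab t : ℝ) = t := by rw [Set.projIcc_of_mem hab ht]
  refine ⟨⟨w, hwm⟩, fun n => ?_, fun n => ?_⟩
  · have h3 := inner_hardyBasis_adjoint_toeplitz hs' (hmem _ (hJ (Set.projIcc a b hab t).2)) n
    change _ = _ * inner ℂ (hardyBasis n) (((K (Set.projIcc a b hab t))†) _)
    rw [hK0, hKd, h3, inner_hardyBasis, hpt]
    exact (hw n).trans ((if_pos n.cast_nonneg).trans (by norm_cast))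
  · obtain ⟨d, hd1, hd2⟩ := hd n
    have h3 := inner_hardyBasis_toeplitz_toLinf hs' (hmem _ (hJ (Set.projIcc a b hab t).2))
      ⟨w, hwm⟩ n
    change HasDerivWithinAt (fun τ => inner ℂ (hardyBasis n)
      (K (Set.projIcc a b hab τ) (hardyBasis 0))) (Complex.I * (_ * inner ℂ (hardyBasis n)
      (K (Set.projIcc a b hab t) (hardyBasis 0)) + _)) _ _
    rw [hKd (Set.projIcc a b hab t), h3, ← hKd]
    simp only [hK0, inner_hardyBasis, hpt]
    have hcomm : (fun x => (u t : L2T) x * w x) = fun x => w x * (u t : L2T) x :=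
      funext fun x => mul_comm _ _
    have hd3 : d = Complex.I * (-(n : ℂ) ^ 2 * fourierCoeff ((u t : L2T) : Torus → ℂ) n
        + 2 * fourierCoeff (fun x => (u t : L2T) x * w x) n) := by
      rw [hcomm]
      push_cast at hd2
      linear_combination (-Complex.I) * hd2 + d * Complex.I_sq
    rw [← hd3]
    refine (hd1.mono hJ).congr (fun τ hτ => ?_) ?_
    · rw [Set.projIcc_of_mem hab hτ]
    · rw [hpt]

end Solutions

end CalogeroSutherland
end

theorem proposition2p6 (s : ℝ) (hs : 3 / 2 < s)
    (u₀ : CalogeroSutherland.hardy) (hu₀ : u₀ ∈ CalogeroSutherland.hardySobolev s) :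
    (∃! W : ℝ → CalogeroSutherland.hardy →L[ℂ] CalogeroSutherland.hardy,
      CalogeroSutherland.IsUnitaryGroupOf
        (CalogeroSutherland.laxOp (CalogeroSutherland.toLinf (by linarith) hu₀)) W) ∧
    ∀ W : ℝ → CalogeroSutherland.hardy →L[ℂ] CalogeroSutherland.hardy,
      CalogeroSutherland.IsUnitaryGroupOf
        (CalogeroSutherland.laxOp (CalogeroSutherland.toLinf (by linarith) hu₀)) W →
    ∀ (I : Set ℝ), I.OrdConnected → (0 : ℝ) ∈ I →
    ∀ u : ℝ → CalogeroSutherland.hardy,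
      CalogeroSutherland.IsSolution s I u → u 0 = u₀ →
    ∀ t ∈ I, ∀ z : ℂ, ‖z‖ < 1 →
      IsUnit (1 - (z * Complex.exp (-(Complex.I * t))) •
        (W (-2 * t) * ContinuousLinearMap.adjoint CalogeroSutherland.shift)) ∧
      HasSum
        (fun k : ℕ => fourierCoeff ((u t : CalogeroSutherland.L2T) :
          CalogeroSutherland.Torus → ℂ) (k : ℤ) * z ^ k)
        (inner ℂ CalogeroSutherland.hardyOne
          (Ring.inverse (1 - (z * Complex.exp (-(Complex.I * t))) •
            (W (-2 * t) * ContinuousLinearMap.adjoint CalogeroSutherland.shift)) u₀)) := by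
  open CalogeroSutherland in
  have hs' : 1 / 2 < s := by linarith
  obtain ⟨ι, b, lam, hb⟩ := exists_eigenbasis_isLax hardyBasis (toeplitz (toLinf hs' hu₀))
  have hA := fun x y => (mem_graph_laxOp (toLinf hs' hu₀) x y).trans (hb x y)
  refine ⟨existsUnique_unitaryGroup_of_eigenbasis b hA, ?_⟩
  intro W hW I hI h0 u hu hu0 t ht z hz
  subst hu0
  have hJ : Set.Icc (min 0 t) (max 0 t) ⊆ I := hI.uIcc_subset h0 ht
  have h0J : (0 : ℝ) ∈ Set.Icc (min 0 t) (max 0 t) := Set.left_mem_uIcc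
  have htJ : t ∈ Set.Icc (min 0 t) (max 0 t) := Set.right_mem_uIcc
  obtain ⟨K, N, C, hflow, hKu, hK0⟩ := hu.exists_isFlow hs hs' min_le_max hJ h0J
  have hmain := hflow.isUnit_and_hasSum b (lam := lam)
    (fun i => by
      rw [hK0]
      exact (mem_graph_laxOp (toLinf hs' hu₀) _ _).1 (mem_graph_eigenbasis b hA i))
    (fun τ i => hW.apply_eigenvector (mem_graph_eigenbasis b hA i) τ) hW.unitary htJ hz
  rw [hKu t htJ, hKu 0 h0J, hardyBasis_zero] at hmain
  simpa only [inner_hardyBasis] using hmain
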